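/- Let $\mathcal X_1,\mathcal X_2,\mathcal X_3,\mathcal Y$ be finite sets, let $p(y|x_1,x_2,x_3)$ be a discrete memoryless channel with inputs $x_1,x_2$ from two sources and $x_3$ from a relay and output $y$ at a single receiver, and let $C_1,C_2\ge 0$. Independent messages $W_1,W_2,W_3$, with $W_i$ uniform on $\mathcal W_i=\{1,\dots,\lceil 2^{nR_i}\rceil\}$, $R_i\ge 0$, originate at source 1, source 2 and the relay. Before transmission, source $i\in\{1,2\}$ sends to the relay over a unidirectional noiseless link of capacity $C_i$ an index $V_i=\varphi_i(W_i)\in\{1,\dots,\lfloor 2^{nC_i}\rfloor\}$. In a code of block length $n$ the sources then transmit $f_i(W_i)\in\mathcal X_i^n$, $i=1,2$, the relay transmits $f_3(V_1,V_2,W_3)\in\mathcal X_3^n$, and the receiver forms an estimate $h(Y^n)\in\mathcal W_1\times\mathcal W_2\times\mathcal W_3$ of the three messages. A triple $(R_1,R_2,R_3)$ is achievable if there is a sequence of such codes, $n=1,2,\dots$, whose average probability $\Pr[h(Y^n)\ne(W_1,W_2,W_3)]$ tends to $0$; the capacity region is the closure of the set of achievable triples. The capacity region equals the closure of the set of all non-negative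 $(R_1,R_2,R_3)$ satisfying \begin{align*} R_1 &\le I(X_1;Y|X_2,X_3,U_1,U_2,Q)+C_1,\\ R_2 &\le I(X_2;Y|X_1,X_3,U_1,U_2,Q)+C_2,\\ R_3 &\le I(X_3;Y|X_1,X_2,U_1,U_2,Q),\\ R_1+R_2 &\le I(X_1,X_2;Y|X_3,U_1,U_2,Q)+C_1+C_2,\\ R_1+R_3 &\le \min\{I(X_1,X_3;Y|X_2,U_1,U_2,Q)+C_1,\ I(X_1,X_3;Y|X_2,U_2,Q)\},\\ R_2+R_3 &\le \min\{I(X_2,X_3;Y|X_1,U_1,U_2,Q)+C_2,\ I(X_2,X_3;Y|X_1,U_1,Q)\},\\ R_1+R_2+R_3 &\le \min\{I(X_1,X_2,X_3;Y|U_1,U_2,Q)+C_1+C_2,\ I(X_1,X_2,X_3;Y|U_1,Q)+C_1,\\ &\qquad\quad\ \, I(X_1,X_2,X_3;Y|U_2,Q)+C_2,\ I(X_1,X_2,X_3;Y|Q)\} \end{align*} for some auxiliary random variables $U_1,U_2,Q$ with finite alphabets and some joint distribution of the form $p(q)\,p(x_1,u_1|q)\,p(x_2,u_2|q)\,p(x_3|u_1,u_2,q)\,p(y|x_1,x_2,x_3)$.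 Mutual informations are in bits. -/

import Mathlib

open scoped Topology

namespace RelayMAC

/-! ### Finite probability and conditional mutual information -/

/-- The probability `P(A = a)` when the finite sample space `Ω` carries the mass function `p`. -/
noncomputable def prob {Ω α : Type*} [Fintype Ω] (p : Ω → ℝ) (A : Ω → α) (a : α) : ℝ :=
  open Classical in ∑ ω with A ω = a, p ω

/-- The conditional mutual information `I(A; B | C)` in bits,
`∑ P(a,b,c) log₂ (P(a,b,c) P(c) / (P(a,c) P(b,c)))`
(the terms with `P(a,b,c) = 0` vanish, and in the others no factor is zero). -/
noncomputable def condMutualInfo {Ω α β γ : Type*} [Fintype Ω] [Fintype α] [Fintype β]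
    [Fintype γ] (p : Ω → ℝ) (A : Ω → α) (B : Ω → β) (C : Ω → γ) : ℝ :=
  ∑ a, ∑ b, ∑ c,
    prob p (fun ω => (A ω, B ω, C ω)) (a, b, c) *
      Real.logb 2
        (prob p (fun ω => (A ω, B ω, C ω)) (a, b, c) * prob p C c /
          (prob p (fun ω => (A ω, C ω)) (a, c) * prob p (fun ω => (B ω, C ω)) (b, c)))

/-! ### Codes, error probability and the capacity region -/

/-- A block code of length `n` with message sets `Fin Mᵢ` and link alphabets `Fin K₁`, `Fin K₂`.
Before the transmission each source sends one letter, a function of its own message, over its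
link; the relay encodes these two letters and its own message. -/
structure Code (X₁ X₂ X₃ Y : Type*) (n M₁ M₂ M₃ K₁ K₂ : ℕ) where
  link₁ : Fin M₁ → Fin K₁
  link₂ : Fin M₂ → Fin K₂
  enc₁ : Fin M₁ → Fin n → X₁
  enc₂ : Fin M₂ → Fin n → X₂
  enc₃ : Fin K₁ → Fin K₂ → Fin M₃ → Fin n → X₃
  dec : (Fin n → Y) → Fin M₁ × Fin M₂ × Fin M₃

/-- The average probability of block error (uniform independent messages) over the memoryless
channel `W`, where `W x₁ x₂ x₃ y = p(y | x₁, x₂, x₃)`. -/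
noncomputable def Code.errorProb {X₁ X₂ X₃ Y : Type*} [Fintype Y] {n M₁ M₂ M₃ K₁ K₂ : ℕ}
    (W : X₁ → X₂ → X₃ → Y → ℝ) (c : Code X₁ X₂ X₃ Y n M₁ M₂ M₃ K₁ K₂) : ℝ :=
  open Classical in
  (∑ w₁ : Fin M₁, ∑ w₂ : Fin M₂, ∑ w₃ : Fin M₃,
    ∑ y : Fin n → Y with c.dec y ≠ (w₁, w₂, w₃),
      ∏ j, W (c.enc₁ w₁ j) (c.enc₂ w₂ j) (c.enc₃ (c.link₁ w₁) (c.link₂ w₂) w₃ j) (y j)) /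
    ((M₁ : ℝ) * (M₂ : ℝ) * (M₃ : ℝ))

/-- The number `⌈2 ^ (n R)⌉` of messages at rate `R` and block length `n`. -/
noncomputable def numMessages (R : ℝ) (n : ℕ) : ℕ := ⌈(2 : ℝ) ^ ((n : ℝ) * R)⌉₊

/-- The number `⌊2 ^ (n C)⌋` of letters that a link of capacity `C` carries in a block of
length `n`. -/
noncomputable def linkSize (C : ℝ) (n : ℕ) : ℕ := ⌊(2 : ℝ) ^ ((n : ℝ) * C)⌋₊

/-- The triple `(R₁, R₂, R₃)` of non-negative rates is achievable when the links have
capacities `C₁` and `C₂`. -/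
def Achievable {X₁ X₂ X₃ Y : Type*} [Fintype Y] (W : X₁ → X₂ → X₃ → Y → ℝ) (C₁ C₂ : ℝ)
    (R : ℝ × ℝ × ℝ) : Prop :=
  (0 ≤ R.1 ∧ 0 ≤ R.2.1 ∧ 0 ≤ R.2.2) ∧
    ∃ c : ∀ n : ℕ, Code X₁ X₂ X₃ Y n (numMessages R.1 n) (numMessages R.2.1 n)
        (numMessages R.2.2 n) (linkSize C₁ n) (linkSize C₂ n),
      Filter.Tendsto (fun n => (c n).errorProb W) Filter.atTop (𝓝 0)

/-- The capacity region: the closure of the set of achievable rate triples. -/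
def capacityRegion {X₁ X₂ X₃ Y : Type*} [Fintype Y] (W : X₁ → X₂ → X₃ → Y → ℝ) (C₁ C₂ : ℝ) :
    Set (ℝ × ℝ × ℝ) :=
  closure {R | Achievable W C₁ C₂ R}

/-! ### The single-letter bounds -/

/-- The factors `p(q)`, `p(x₁,u₁|q)`, `p(x₂,u₂|q)`, `p(x₃|u₁,u₂,q)` of an input distribution. -/
structure InputLaw (Q U₁ U₂ X₁ X₂ X₃ : Type*) [Fintype Q] [Fintype U₁] [Fintype U₂]
    [Fintype X₁] [Fintype X₂] [Fintype X₃] where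
  pQ : Q → ℝ
  p₁ : Q → X₁ × U₁ → ℝ
  p₂ : Q → X₂ × U₂ → ℝ
  p₃ : Q → U₁ → U₂ → X₃ → ℝ
  pQ_mem : pQ ∈ stdSimplex ℝ Q
  p₁_mem : ∀ q, p₁ q ∈ stdSimplex ℝ (X₁ × U₁)
  p₂_mem : ∀ q, p₂ q ∈ stdSimplex ℝ (X₂ × U₂)
  p₃_mem : ∀ q u₁ u₂, p₃ q u₁ u₂ ∈ stdSimplex ℝ X₃

section Bounds

variable {Q U₁ U₂ X₁ X₂ X₃ Y : Type*} [Fintype Q] [Fintype U₁] [Fintype U₂]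
    [Fintype X₁] [Fintype X₂] [Fintype X₃] [Fintype Y]

/-- The joint mass function
`p(q) p(x₁,u₁|q) p(x₂,u₂|q) p(x₃|u₁,u₂,q) p(y|x₁,x₂,x₃)` of `(Q, U₁, U₂, X₁, X₂, X₃, Y)`. -/
def InputLaw.joint (P : InputLaw Q U₁ U₂ X₁ X₂ X₃) (W : X₁ → X₂ → X₃ → Y → ℝ) :
    Q × U₁ × U₂ × X₁ × X₂ × X₃ × Y → ℝ :=
  fun (q, u₁, u₂, x₁, x₂, x₃, y) =>
    P.pQ q * P.p₁ q (x₁, u₁) * P.p₂ q (x₂, u₂) * P.p₃ q u₁ u₂ x₃ * W x₁ x₂ x₃ y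

/-- The bounds on the rates `(R₁, R₂, R₃)` for a given input distribution. -/
def InputLaw.Bounds (P : InputLaw Q U₁ U₂ X₁ X₂ X₃) (W : X₁ → X₂ → X₃ → Y → ℝ) (C₁ C₂ : ℝ)
    (R₁ R₂ R₃ : ℝ) : Prop :=
  R₁ ≤ condMutualInfo (P.joint W)
      (fun (_, _, _, x₁, _, _, _) => x₁)
      (fun (_, _, _, _, _, _, y) => y)
      (fun (q, u₁, u₂, _, x₂, x₃, _) => (x₂, x₃, u₁, u₂, q)) + C₁ ∧
  R₂ ≤ condMutualInfo (P.joint W)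
      (fun (_, _, _, _, x₂, _, _) => x₂)
      (fun (_, _, _, _, _, _, y) => y)
      (fun (q, u₁, u₂, x₁, _, x₃, _) => (x₁, x₃, u₁, u₂, q)) + C₂ ∧
  R₃ ≤ condMutualInfo (P.joint W)
      (fun (_, _, _, _, _, x₃, _) => x₃)
      (fun (_, _, _, _, _, _, y) => y)
      (fun (q, u₁, u₂, x₁, x₂, _, _) => (x₁, x₂, u₁, u₂, q)) ∧
  R₁ + R₂ ≤ condMutualInfo (P.joint W)
      (fun (_, _, _, x₁, x₂, _, _) => (x₁, x₂))
      (fun (_, _, _, _, _, _, y) => y)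
      (fun (q, u₁, u₂, _, _, x₃, _) => (x₃, u₁, u₂, q)) + C₁ + C₂ ∧
  R₁ + R₃ ≤ min
    (condMutualInfo (P.joint W)
      (fun (_, _, _, x₁, _, x₃, _) => (x₁, x₃))
      (fun (_, _, _, _, _, _, y) => y)
      (fun (q, u₁, u₂, _, x₂, _, _) => (x₂, u₁, u₂, q)) + C₁)
    (condMutualInfo (P.joint W)
      (fun (_, _, _, x₁, _, x₃, _) => (x₁, x₃))
      (fun (_, _, _, _, _, _, y) => y)
      (fun (q, _, u₂, _, x₂, _, _) => (x₂, u₂, q))) ∧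
  R₂ + R₃ ≤ min
    (condMutualInfo (P.joint W)
      (fun (_, _, _, _, x₂, x₃, _) => (x₂, x₃))
      (fun (_, _, _, _, _, _, y) => y)
      (fun (q, u₁, u₂, x₁, _, _, _) => (x₁, u₁, u₂, q)) + C₂)
    (condMutualInfo (P.joint W)
      (fun (_, _, _, _, x₂, x₃, _) => (x₂, x₃))
      (fun (_, _, _, _, _, _, y) => y)
      (fun (q, u₁, _, x₁, _, _, _) => (x₁, u₁, q))) ∧
  R₁ + R₂ + R₃ ≤ min
    (min
      (condMutualInfo (P.joint W)
        (fun (_, _, _, x₁, x₂, x₃, _) => (x₁, x₂, x₃))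
        (fun (_, _, _, _, _, _, y) => y)
        (fun (q, u₁, u₂, _, _, _, _) => (u₁, u₂, q)) + C₁ + C₂)
      (condMutualInfo (P.joint W)
        (fun (_, _, _, x₁, x₂, x₃, _) => (x₁, x₂, x₃))
        (fun (_, _, _, _, _, _, y) => y)
        (fun (q, u₁, _, _, _, _, _) => (u₁, q)) + C₁))
    (min
      (condMutualInfo (P.joint W)
        (fun (_, _, _, x₁, x₂, x₃, _) => (x₁, x₂, x₃))
        (fun (_, _, _, _, _, _, y) => y)
        (fun (q, _, u₂, _, _, _, _) => (u₂, q)) + C₂)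
      (condMutualInfo (P.joint W)
        (fun (_, _, _, x₁, x₂, x₃, _) => (x₁, x₂, x₃))
        (fun (_, _, _, _, _, _, y) => y)
        (fun (q, _, _, _, _, _, _) => q)))

end Bounds

/-- The single-letter region: the closure of the set of all non-negative rate triples that satisfy
the bounds for some auxiliary variables `U₁`, `U₂`, `Q` with finite alphabets and some input
distribution. -/
def rateRegion {X₁ X₂ X₃ Y : Type*} [Fintype X₁] [Fintype X₂] [Fintype X₃] [Fintype Y]
    (W : X₁ → X₂ → X₃ → Y → ℝ) (C₁ C₂ : ℝ) : Set (ℝ × ℝ × ℝ) :=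
  closure {R | (0 ≤ R.1 ∧ 0 ≤ R.2.1 ∧ 0 ≤ R.2.2) ∧
    ∃ (Q U₁ U₂ : Type) (_ : Fintype Q) (_ : Fintype U₁) (_ : Fintype U₂)
      (P : InputLaw Q U₁ U₂ X₁ X₂ X₃), P.Bounds W C₁ C₂ R.1 R.2.1 R.2.2}

end RelayMAC

/-! The twelve bounds are instances of one inequality. A `Pattern` records which of the coordinates
u₁, x₁, u₂, x₂, x₃ two message triples share; exactly twelve patterns are `Valid`. The exponent
`Pattern.rate` of the number of triples sharing a given pattern with a fixed one is to be at most
`classInfo`, the information between input and output given the shared coordinates and q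
(`InputLaw.bounds_iff`).

Converse: for a given code let Q be a uniform time index and Uᵢ the letter on link i. For each
pattern, compare the true channel with the product over time of its averages given the known
coordinates. Under this product law the output distribution depends only on the known part of the
message triple, so a decoder succeeds with probability at most (number of known parts)/(number of
triples). Under the true channel it succeeds almost surely, and the divergence of the two laws, n
times the single-letter information, must pay for the difference (`mul_logb_sub_one_le`,
`Code.converse`). This yields the single-letter bounds without a chain rule for entropies.

Achievability: superposition coding, with messages distributed over the link letters by residues.
The decoder accepts a triple when, for every valid pattern, its information density exceeds a
threshold. The true triple fails a threshold with exponentially small probability by Chernoff's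
bound; a competitor passes one with probability at most exp(-nτ) by a change of measure
(`exists_codebook`, `FactoredLaw.exists_code`). The latter rests on the law of two codewords: mass
times a conditional law that keeps the shared coordinates and resamples the others
(`FactoredLaw.sum_bookMass_mul`, `FactoredLaw.classKernel_mass`). Counting competitors by pattern
(`eventually_card_pattern_le`) finishes the bound.

Both inclusions scale the rates by l < 1 and let l tend to 1: in the converse the slack absorbs the
error probability and the additive constant, in achievability it makes the needed inequalities
strict. -/

namespace RelayMAC

/-! ### Information of a channel with respect to an equivalence of its inputs -/

section Info

variable {Z Y : Type*} [Fintype Z] [Fintype Y]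

open Classical in
/-- The probability of the class of `z` under the relation `r`. -/
noncomputable def classMass (P : Z → ℝ) (r : Z → Z → Prop) (z : Z) : ℝ :=
  ∑ z' with r z' z, P z'

open Classical in
/-- The probability that the input is in the class of `z` and the output is `y`. -/
noncomputable def classOut (P : Z → ℝ) (V : Z → Y → ℝ) (r : Z → Z → Prop) (z : Z) (y : Y) : ℝ :=
  ∑ z' with r z' z, P z' * V z' y

/-- The conditional law of the output given the class of the input. -/
noncomputable def classKernel (P : Z → ℝ) (V : Z → Y → ℝ) (r : Z → Z → Prop) (z : Z) (y : Y) : ℝ :=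
  classOut P V r z y / classMass P r z

/-- The information, in bits, between input and output given the class of the input. -/
noncomputable def classInfo (P : Z → ℝ) (V : Z → Y → ℝ) (r : Z → Z → Prop) : ℝ :=
  ∑ z, ∑ y, P z * V z y * Real.logb 2 (V z y / classKernel P V r z y)

variable {P : Z → ℝ} {V : Z → Y → ℝ} {r : Z → Z → Prop}

theorem classMass_pos (hP : ∀ z, 0 ≤ P z) (hr : ∀ z, r z z) {z : Z} (hz : P z ≠ 0) :
    0 < classMass P r z := by
  classical
  refine lt_of_lt_of_le (lt_of_le_of_ne (hP z) (Ne.symm hz)) ?_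
  exact Finset.single_le_sum (f := P) (fun i _ => hP i) (by simp [hr])

omit [Fintype Y] in
theorem classOut_nonneg (hP : ∀ z, 0 ≤ P z) (hV : ∀ z y, 0 ≤ V z y) (z : Z) (y : Y) :
    0 ≤ classOut P V r z y :=
  Finset.sum_nonneg fun i _ => mul_nonneg (hP i) (hV i y)

theorem classMass_nonneg (hP : ∀ z, 0 ≤ P z) (z : Z) : 0 ≤ classMass P r z :=
  Finset.sum_nonneg fun i _ => hP i

omit [Fintype Y] in
theorem classKernel_nonneg (hP : ∀ z, 0 ≤ P z) (hV : ∀ z y, 0 ≤ V z y) (z : Z) (y : Y) :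
    0 ≤ classKernel P V r z y :=
  div_nonneg (classOut_nonneg hP hV z y) (classMass_nonneg hP z)

omit [Fintype Y] in
theorem classKernel_pos (hP : ∀ z, 0 ≤ P z) (hV : ∀ z y, 0 ≤ V z y) (hr : ∀ z, r z z) {z : Z}
    {y : Y} (hz : P z ≠ 0) (hy : V z y ≠ 0) : 0 < classKernel P V r z y := by
  classical
  refine div_pos ?_ (classMass_pos hP hr hz)
  refine lt_of_lt_of_le (b := P z * V z y) ?_ ?_
  · exact mul_pos (lt_of_le_of_ne (hP z) (Ne.symm hz)) (lt_of_le_of_ne (hV z y) (Ne.symm hy))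
  · exact Finset.single_le_sum (f := fun z => P z * V z y)
      (fun i _ => mul_nonneg (hP i) (hV i y)) (by simp [hr])

theorem sum_classKernel (hP : ∀ z, 0 ≤ P z) (hV : ∀ z, ∑ y, V z y = 1) (hr : ∀ z, r z z) {z : Z}
    (hz : P z ≠ 0) : ∑ y, classKernel P V r z y = 1 := by
  classical
  unfold classKernel
  rw [← Finset.sum_div, div_eq_one_iff_eq (classMass_pos hP hr hz).ne']
  unfold classOut classMass
  rw [Finset.sum_comm]
  simp [← Finset.mul_sum, hV]

omit [Fintype Y] in
theorem classKernel_congr (hr : ∀ a b c, r a b → r b c → r a c) {z z' : Z} (h : r z z')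
    (h' : r z' z) : classKernel P V r z = classKernel P V r z' := by
  classical
  have : ∀ a, r a z ↔ r a z' := fun a => ⟨fun k => hr _ _ _ k h, fun k => hr _ _ _ k h'⟩
  funext y
  simp [classKernel, classOut, classMass, this]

end Info

/-! ### Conditional mutual information as information of a channel -/

section Prob

variable {Ω Ω' α β γ : Type*} [Fintype Ω] [Fintype Ω'] [Fintype α] [Fintype β] [Fintype γ]

theorem sum_prob_mul (p : Ω → ℝ) (A : Ω → α) (F : α → ℝ) :
    ∑ a, prob p A a * F a = ∑ ω, p ω * F (A ω) := by
  classical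
  simp only [prob, Finset.sum_mul]
  rw [← Finset.sum_fiberwise (s := Finset.univ) (g := A)]
  refine Finset.sum_congr rfl fun a _ => ?_
  refine Finset.sum_congr (by ext; simp) fun ω hω => ?_
  rw [(Finset.mem_filter.1 hω).2]

omit [Fintype α] in
theorem prob_comp_equiv (e : Ω' ≃ Ω) (p : Ω → ℝ) (A : Ω → α) (a : α) :
    prob (fun ω => p (e ω)) (fun ω => A (e ω)) a = prob p A a := by
  classical
  simp only [prob, Finset.sum_filter]
  exact Fintype.sum_equiv e _ _ fun _ => rfl

theorem condMutualInfo_comp_equiv (e : Ω' ≃ Ω) (p : Ω → ℝ) (A : Ω → α) (B : Ω → β) (C : Ω → γ) :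
    condMutualInfo (fun ω => p (e ω)) (fun ω => A (e ω)) (fun ω => B (e ω)) (fun ω => C (e ω)) =
      condMutualInfo p A B C := by
  unfold condMutualInfo
  simp_rw [prob_comp_equiv e p C, prob_comp_equiv e p (fun ω => (A ω, B ω, C ω)),
    prob_comp_equiv e p (fun ω => (A ω, C ω)), prob_comp_equiv e p (fun ω => (B ω, C ω))]

theorem condMutualInfo_eq_sum (p : Ω → ℝ) (A : Ω → α) (B : Ω → β) (C : Ω → γ) :
    condMutualInfo p A B C = ∑ ω, p ω * Real.logb 2
      (prob p (fun ω => (A ω, B ω, C ω)) (A ω, B ω, C ω) * prob p C (C ω) /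
        (prob p (fun ω => (A ω, C ω)) (A ω, C ω) * prob p (fun ω => (B ω, C ω)) (B ω, C ω))) := by
  rw [← sum_prob_mul p (fun ω => (A ω, B ω, C ω)) (fun x => Real.logb 2
      (prob p (fun ω => (A ω, B ω, C ω)) x * prob p C x.2.2 /
        (prob p (fun ω => (A ω, C ω)) (x.1, x.2.2) *
          prob p (fun ω => (B ω, C ω)) (x.2.1, x.2.2))))]
  simp only [condMutualInfo, Fintype.sum_prod_type]

end Prob

/-- By `hac`, the values of `a` and `c` already determine the output law, so P(a,b,c) is P(a,c)
times the channel. The factor P(a,c) cancels in the quotient, and what is left is the channel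
divided by its average over the class of `c`. -/
theorem condMutualInfo_eq_classInfo {Z Y α γ : Type*} [Fintype Z] [Fintype Y] [Fintype α]
    [Fintype γ] {P : Z → ℝ} {V : Z → Y → ℝ} {r : Z → Z → Prop} (hP : ∀ z, 0 ≤ P z)
    (hV : ∀ z, ∑ y, V z y = 1) (a : Z → α) (c : Z → γ) (hr : ∀ z z', r z' z ↔ c z' = c z)
    (hac : ∀ z z', a z' = a z → c z' = c z → V z' = V z) :
    condMutualInfo (fun ω : Z × Y => P ω.1 * V ω.1 ω.2) (fun ω => a ω.1) (fun ω => ω.2)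
      (fun ω => c ω.1) = classInfo P V r := by
  classical
  rw [condMutualInfo_eq_sum, Fintype.sum_prod_type, classInfo]
  refine Finset.sum_congr rfl fun z _ => Finset.sum_congr rfl fun y _ => ?_
  by_cases hz : P z = 0
  · simp [hz]
  dsimp only
  congr 2
  set m : ℝ := ∑ z' with (a z' = a z ∧ c z' = c z), P z' with hm
  have hmpos : 0 < m := by
    refine lt_of_lt_of_le (lt_of_le_of_ne (hP z) (Ne.symm hz)) ?_
    exact Finset.single_le_sum (f := P) (fun i _ => hP i) (by simp)
  have h1 : prob (fun ω : Z × Y => P ω.1 * V ω.1 ω.2) (fun ω => (a ω.1, ω.2, c ω.1))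
      (a z, y, c z) = m * V z y := by
    simp only [prob, Finset.sum_filter, Fintype.sum_prod_type, hm, Finset.sum_mul, Prod.mk.injEq]
    refine Finset.sum_congr rfl fun z' _ => ?_
    by_cases h : a z' = a z ∧ c z' = c z
    · simp [h.1, h.2, hac z z' h.1 h.2]
    · rw [if_neg h, zero_mul]
      exact Finset.sum_eq_zero fun y' _ => if_neg fun k => h ⟨k.1, k.2.2⟩
  have h2 : prob (fun ω : Z × Y => P ω.1 * V ω.1 ω.2) (fun ω => c ω.1) (c z) =
      classMass P r z := by
    simp only [prob, Finset.sum_filter, Fintype.sum_prod_type, classMass, hr]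
    refine Finset.sum_congr rfl fun z' _ => ?_
    split_ifs <;> simp [← Finset.mul_sum, hV]
  have h3 : prob (fun ω : Z × Y => P ω.1 * V ω.1 ω.2) (fun ω => (a ω.1, c ω.1))
      (a z, c z) = m := by
    simp only [prob, Finset.sum_filter, Fintype.sum_prod_type, hm, Prod.mk.injEq]
    refine Finset.sum_congr rfl fun z' _ => ?_
    split_ifs <;> simp [← Finset.mul_sum, hV]
  have h4 : prob (fun ω : Z × Y => P ω.1 * V ω.1 ω.2) (fun ω => (ω.2, c ω.1))
      (y, c z) = classOut P V r z y := by
    simp only [prob, Finset.sum_filter, Fintype.sum_prod_type, classOut, hr, Prod.mk.injEq]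
    refine Finset.sum_congr rfl fun z' _ => ?_
    by_cases h : c z' = c z <;> simp [h]
  rw [h1, h2, h3, h4, classKernel]
  rw [mul_assoc, mul_div_mul_left _ _ hmpos.ne', div_div_eq_mul_div]

/-! ### Patterns of shared coordinates -/

/-- Which of the coordinates `u₁, x₁, u₂, x₂, x₃` of two inputs are required to coincide. -/
structure Pattern where
  u₁ : Bool
  x₁ : Bool
  u₂ : Bool
  x₂ : Bool
  x₃ : Bool
deriving DecidableEq, Fintype

/-- The patterns that arise for two different message triples: `xᵢ` is generated from `uᵢ`, and
`x₃` from `u₁` and `u₂`. -/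
def Pattern.Valid (f : Pattern) : Prop :=
  (f.x₁ → f.u₁) ∧ (f.x₂ → f.u₂) ∧ (f.x₃ → f.u₁ ∧ f.u₂) ∧ ¬(f.x₁ ∧ f.x₂ ∧ f.x₃)

instance (f : Pattern) : Decidable f.Valid := by unfold Pattern.Valid; infer_instance

/-- The two inputs agree on the time-sharing variable and on the coordinates in the pattern. -/
def Pattern.Agree (f : Pattern) {Q U₁ U₂ X₁ X₂ X₃ : Type*}
    (z z' : Q × U₁ × U₂ × X₁ × X₂ × X₃) : Prop :=
  z.1 = z'.1 ∧ (f.u₁ → z.2.1 = z'.2.1) ∧ (f.u₂ → z.2.2.1 = z'.2.2.1) ∧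
    (f.x₁ → z.2.2.2.1 = z'.2.2.2.1) ∧ (f.x₂ → z.2.2.2.2.1 = z'.2.2.2.2.1) ∧
    (f.x₃ → z.2.2.2.2.2 = z'.2.2.2.2.2)

theorem Pattern.Agree.refl (f : Pattern) {Q U₁ U₂ X₁ X₂ X₃ : Type*}
    (z : Q × U₁ × U₂ × X₁ × X₂ × X₃) : f.Agree z z := by simp [Pattern.Agree]

theorem Pattern.Agree.trans {f : Pattern} {Q U₁ U₂ X₁ X₂ X₃ : Type*}
    {z z' z'' : Q × U₁ × U₂ × X₁ × X₂ × X₃} (h : f.Agree z z') (h' : f.Agree z' z'') :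
    f.Agree z z'' := by
  obtain ⟨a, b, c, d, e, g⟩ := h
  obtain ⟨a', b', c', d', e', g'⟩ := h'
  exact ⟨a.trans a', fun k => (b k).trans (b' k), fun k => (c k).trans (c' k),
    fun k => (d k).trans (d' k), fun k => (e k).trans (e' k), fun k => (g k).trans (g' k)⟩

/-- The exponent of the number of messages of a source of rate `R` with link capacity `C`, given
the letter on the link (if `u`) or the message itself (if `x`). -/
def sourceRate (u x : Bool) (R C : ℝ) : ℝ := if x then 0 else if u then R - C else R

/-- The exponent of the number of message triples that share the given pattern with a fixed one. -/
def Pattern.rate (f : Pattern) (C₁ C₂ R₁ R₂ R₃ : ℝ) : ℝ :=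
  sourceRate f.u₁ f.x₁ R₁ C₁ + sourceRate f.u₂ f.x₂ R₂ C₂ + if f.x₃ then 0 else R₃

/-- The channel as a kernel from the tuples `(q, u₁, u₂, x₁, x₂, x₃)`. -/
def letterChannel {X₁ X₂ X₃ Y : Type*} (Q U₁ U₂ : Type*) (W : X₁ → X₂ → X₃ → Y → ℝ) :
    Q × U₁ × U₂ × X₁ × X₂ × X₃ → Y → ℝ :=
  fun z => W z.2.2.2.1 z.2.2.2.2.1 z.2.2.2.2.2

section Bounds

variable {Q U₁ U₂ X₁ X₂ X₃ Y : Type*} [Fintype Q] [Fintype U₁] [Fintype U₂]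
    [Fintype X₁] [Fintype X₂] [Fintype X₃] [Fintype Y]

/-- The mass function of `(q, u₁, u₂, x₁, x₂, x₃)`. -/
def InputLaw.input (P : InputLaw Q U₁ U₂ X₁ X₂ X₃) : Q × U₁ × U₂ × X₁ × X₂ × X₃ → ℝ :=
  fun (q, u₁, u₂, x₁, x₂, x₃) =>
    P.pQ q * P.p₁ q (x₁, u₁) * P.p₂ q (x₂, u₂) * P.p₃ q u₁ u₂ x₃

theorem InputLaw.input_nonneg (P : InputLaw Q U₁ U₂ X₁ X₂ X₃) (z) : 0 ≤ P.input z := by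
  obtain ⟨q, u₁, u₂, x₁, x₂, x₃⟩ := z
  exact mul_nonneg (mul_nonneg (mul_nonneg (P.pQ_mem.1 _) ((P.p₁_mem _).1 _))
    ((P.p₂_mem _).1 _)) ((P.p₃_mem _ _ _).1 _)

/-- Only the three channel inputs need to be recoverable from `a` and `c`: unconditioned auxiliary
variables may be dropped, since the output depends on them through the inputs alone. -/
theorem InputLaw.condMutualInfo_eq (P : InputLaw Q U₁ U₂ X₁ X₂ X₃) {W : X₁ → X₂ → X₃ → Y → ℝ}
    (hW : ∀ x₁ x₂ x₃, W x₁ x₂ x₃ ∈ stdSimplex ℝ Y) {α γ : Type*} [Fintype α] [Fintype γ]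
    (f : Pattern) (A : Q × U₁ × U₂ × X₁ × X₂ × X₃ × Y → α) (C : Q × U₁ × U₂ × X₁ × X₂ × X₃ × Y → γ)
    (a : Q × U₁ × U₂ × X₁ × X₂ × X₃ → α) (c : Q × U₁ × U₂ × X₁ × X₂ × X₃ → γ)
    (hA : ∀ q u₁ u₂ x₁ x₂ x₃ y, A (q, u₁, u₂, x₁, x₂, x₃, y) = a (q, u₁, u₂, x₁, x₂, x₃))
    (hC : ∀ q u₁ u₂ x₁ x₂ x₃ y, C (q, u₁, u₂, x₁, x₂, x₃, y) = c (q, u₁, u₂, x₁, x₂, x₃))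
    (hr : ∀ z z', f.Agree z' z ↔ c z' = c z)
    (hac : ∀ z z', a z' = a z → c z' = c z → z'.2.2.2 = z.2.2.2) :
    condMutualInfo (P.joint W) A (fun (_, _, _, _, _, _, y) => y) C =
      classInfo P.input (letterChannel Q U₁ U₂ W) f.Agree := by
  let e : (Q × U₁ × U₂ × X₁ × X₂ × X₃) × Y ≃ Q × U₁ × U₂ × X₁ × X₂ × X₃ × Y :=
    { toFun := fun ω => (ω.1.1, ω.1.2.1, ω.1.2.2.1, ω.1.2.2.2.1, ω.1.2.2.2.2.1, ω.1.2.2.2.2.2, ω.2)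
      invFun := fun ω => ((ω.1, ω.2.1, ω.2.2.1, ω.2.2.2.1, ω.2.2.2.2.1, ω.2.2.2.2.2.1),
        ω.2.2.2.2.2.2)
      left_inv := fun _ => rfl
      right_inv := fun _ => rfl }
  rw [← condMutualInfo_comp_equiv e,
    ← condMutualInfo_eq_classInfo (V := letterChannel Q U₁ U₂ W) P.input_nonneg
      (fun z => (hW _ _ _).2) a c hr]
  · simp only [e, hA, hC]
    rfl
  · intro z z' h1 h2
    have := hac z z' h1 h2
    simp [letterChannel, this]

/-- Each source is unknown, known through its link letter, or fully known, and x₃ can be shared only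
if both link letters are; excluding complete agreement leaves exactly twelve patterns. A link
capacity enters a bound precisely when the link letter is known but the message is not. -/
theorem InputLaw.bounds_iff (P : InputLaw Q U₁ U₂ X₁ X₂ X₃) {W : X₁ → X₂ → X₃ → Y → ℝ}
    (hW : ∀ x₁ x₂ x₃, W x₁ x₂ x₃ ∈ stdSimplex ℝ Y) (C₁ C₂ R₁ R₂ R₃ : ℝ) :
    P.Bounds W C₁ C₂ R₁ R₂ R₃ ↔ ∀ f : Pattern, f.Valid →
      f.rate C₁ C₂ R₁ R₂ R₃ ≤ classInfo P.input (letterChannel Q U₁ U₂ W) f.Agree := by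
  unfold InputLaw.Bounds
  rw [P.condMutualInfo_eq hW ⟨true, false, true, true, true⟩ _ _
      (fun z => z.2.2.2.1) (fun z => (z.2.2.2.2.1, z.2.2.2.2.2, z.2.1, z.2.2.1, z.1)) ?_ ?_ ?_ ?_,
    P.condMutualInfo_eq hW ⟨true, true, true, false, true⟩ _ _
      (fun z => z.2.2.2.2.1) (fun z => (z.2.2.2.1, z.2.2.2.2.2, z.2.1, z.2.2.1, z.1)) ?_ ?_ ?_ ?_,
    P.condMutualInfo_eq hW ⟨true, true, true, true, false⟩ _ _
      (fun z => z.2.2.2.2.2) (fun z => (z.2.2.2.1, z.2.2.2.2.1, z.2.1, z.2.2.1, z.1)) ?_ ?_ ?_ ?_,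
    P.condMutualInfo_eq hW ⟨true, false, true, false, true⟩ _ _
      (fun z => (z.2.2.2.1, z.2.2.2.2.1)) (fun z => (z.2.2.2.2.2, z.2.1, z.2.2.1, z.1)) ?_ ?_ ?_ ?_,
    P.condMutualInfo_eq hW ⟨true, false, true, true, false⟩ _ _
      (fun z => (z.2.2.2.1, z.2.2.2.2.2)) (fun z => (z.2.2.2.2.1, z.2.1, z.2.2.1, z.1)) ?_ ?_ ?_ ?_,
    P.condMutualInfo_eq hW ⟨false, false, true, true, false⟩ _ _
      (fun z => (z.2.2.2.1, z.2.2.2.2.2)) (fun z => (z.2.2.2.2.1, z.2.2.1, z.1)) ?_ ?_ ?_ ?_,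
    P.condMutualInfo_eq hW ⟨true, true, true, false, false⟩ _ _
      (fun z => (z.2.2.2.2.1, z.2.2.2.2.2)) (fun z => (z.2.2.2.1, z.2.1, z.2.2.1, z.1)) ?_ ?_ ?_ ?_,
    P.condMutualInfo_eq hW ⟨true, true, false, false, false⟩ _ _
      (fun z => (z.2.2.2.2.1, z.2.2.2.2.2)) (fun z => (z.2.2.2.1, z.2.1, z.1)) ?_ ?_ ?_ ?_,
    P.condMutualInfo_eq hW ⟨true, false, true, false, false⟩ _ _
      (fun z => (z.2.2.2.1, z.2.2.2.2.1, z.2.2.2.2.2)) (fun z => (z.2.1, z.2.2.1, z.1)) ?_ ?_ ?_ ?_,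
    P.condMutualInfo_eq hW ⟨true, false, false, false, false⟩ _ _
      (fun z => (z.2.2.2.1, z.2.2.2.2.1, z.2.2.2.2.2)) (fun z => (z.2.1, z.1)) ?_ ?_ ?_ ?_,
    P.condMutualInfo_eq hW ⟨false, false, true, false, false⟩ _ _
      (fun z => (z.2.2.2.1, z.2.2.2.2.1, z.2.2.2.2.2)) (fun z => (z.2.2.1, z.1)) ?_ ?_ ?_ ?_,
    P.condMutualInfo_eq hW ⟨false, false, false, false, false⟩ _ _
      (fun z => (z.2.2.2.1, z.2.2.2.2.1, z.2.2.2.2.2)) (fun z => z.1) ?_ ?_ ?_ ?_]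
  · set I : Pattern → ℝ := fun f => classInfo P.input (letterChannel Q U₁ U₂ W) f.Agree with hI
    constructor
    · rintro ⟨h1, h2, h3, h4, h5, h6, h7⟩
      simp only [le_min_iff] at h5 h6 h7
      rintro ⟨_ | _, _ | _, _ | _, _ | _, _ | _⟩ hf <;>
        first
        | (exfalso; revert hf; decide)
        | (simp only [Pattern.rate, sourceRate, Bool.false_eq_true, if_true, if_false]; linarith)
    · intro h
      have h1 := h ⟨true, false, true, true, true⟩ (by decide)
      have h2 := h ⟨true, true, true, false, true⟩ (by decide)
      have h3 := h ⟨true, true, true, true, false⟩ (by decide)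
      have h4 := h ⟨true, false, true, false, true⟩ (by decide)
      have h5 := h ⟨true, false, true, true, false⟩ (by decide)
      have h6 := h ⟨false, false, true, true, false⟩ (by decide)
      have h7 := h ⟨true, true, true, false, false⟩ (by decide)
      have h8 := h ⟨true, true, false, false, false⟩ (by decide)
      have h9 := h ⟨true, false, true, false, false⟩ (by decide)
      have h10 := h ⟨true, false, false, false, false⟩ (by decide)
      have h11 := h ⟨false, false, true, false, false⟩ (by decide)
      have h12 := h ⟨false, false, false, false, false⟩ (by decide)
      simp only [Pattern.rate, sourceRate, Bool.false_eq_true, if_true, if_false] at h1 h2 h3 h4 h5 h6 h7 h8 h9 h10 h11 h12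
      simp only [le_min_iff]
      refine ⟨?_, ?_, ?_, ?_, ⟨?_, ?_⟩, ⟨?_, ?_⟩, ⟨?_, ?_⟩, ?_, ?_⟩ <;> linarith
  all_goals first
    | (intros; rfl)
    | (rintro ⟨q, u₁, u₂, x₁, x₂, x₃⟩ ⟨q', u₁', u₂', x₁', x₂', x₃'⟩
       simp only [Pattern.Agree, Prod.mk.injEq, Bool.false_eq_true]; tauto)

end Bounds

/-! ### Sums over products of mass functions -/

section ProductSums

variable {ι A : Type*} [Fintype ι] [DecidableEq ι] [Fintype A]

theorem sum_prod_apply (p : ι → A → ℝ) : ∑ f : ι → A, ∏ i, p i (f i) = ∏ i, ∑ a, p i a := by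
  rw [Finset.prod_univ_sum, Fintype.piFinset_univ]

theorem sum_prod_eq_one {p : ι → A → ℝ} (hp : ∀ i, ∑ a, p i a = 1) :
    ∑ f : ι → A, ∏ i, p i (f i) = 1 := by
  simp [sum_prod_apply, hp]

theorem sum_prod_mul_apply {p : ι → A → ℝ} (hp : ∀ i, ∑ a, p i a = 1) (i₀ : ι) (h : A → ℝ) :
    ∑ f : ι → A, (∏ i, p i (f i)) * h (f i₀) = ∑ a, p i₀ a * h a := by
  have key : ∀ f : ι → A, (∏ i, p i (f i)) * h (f i₀) =
      ∏ i, (p i (f i) * if i = i₀ then h (f i) else 1) := fun f => by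
    rw [Finset.prod_mul_distrib]; simp
  simp_rw [key]
  rw [sum_prod_apply (fun i a => p i a * if i = i₀ then h a else 1),
    Finset.prod_eq_single i₀ (fun i _ hi => by simp [hi, hp]) (by simp)]
  simp

theorem sum_prod_mul_apply₂ {p : ι → A → ℝ} (hp : ∀ i, ∑ a, p i a = 1) {i₀ i₁ : ι} (hne : i₀ ≠ i₁)
    (g : A → A → ℝ) :
    ∑ f : ι → A, (∏ i, p i (f i)) * g (f i₀) (f i₁) = ∑ a, ∑ b, p i₀ a * p i₁ b * g a b := by
  classical
  have key : ∀ a b, ∑ f : ι → A, (∏ i, p i (f i)) * (if f i₀ = a ∧ f i₁ = b then 1 else 0) =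
      p i₀ a * p i₁ b := by
    intro a b
    have h1 : ∀ f : ι → A, (∏ i, p i (f i)) * (if f i₀ = a ∧ f i₁ = b then 1 else 0) =
        ∏ i, (p i (f i) * ((if i = i₀ then (if f i = a then 1 else 0) else 1) *
          (if i = i₁ then (if f i = b then 1 else 0) else 1))) := fun f => by
      rw [Finset.prod_mul_distrib, Finset.prod_mul_distrib]
      by_cases h : f i₀ = a <;> by_cases h' : f i₁ = b <;> simp [h, h']
    simp_rw [h1]
    rw [sum_prod_apply (fun i c => p i c * ((if i = i₀ then (if c = a then 1 else 0) else 1) *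
          (if i = i₁ then (if c = b then 1 else 0) else 1))),
      Finset.prod_eq_mul i₀ i₁ hne (fun i _ hi => by simp [hi.1, hi.2, hp]) (by simp) (by simp)]
    simp [hne, hne.symm]
  simp_rw [← key, Finset.sum_mul]
  rw [Finset.sum_congr rfl fun a _ => Finset.sum_comm, Finset.sum_comm]
  refine Finset.sum_congr rfl fun f _ => ?_
  rw [Finset.sum_eq_single (f i₀), Finset.sum_eq_single (f i₁)]
  · simp
  · intro b _ hb; simp [hb.symm]
  · simp
  · intro b _ hb; simp [hb.symm]
  · simp

end ProductSums

/-! ### Divergence -/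

theorem sum_mul_logb_div_nonneg {Ω : Type*} [Fintype Ω] {p q : Ω → ℝ} (hp : ∀ ω, 0 ≤ p ω)
    (hq : ∀ ω, 0 ≤ q ω) (hpq : ∀ ω, p ω ≠ 0 → q ω ≠ 0) (hsum : ∑ ω, q ω ≤ ∑ ω, p ω) :
    0 ≤ ∑ ω, p ω * Real.logb 2 (p ω / q ω) := by
  have h2 : 0 < Real.log 2 := Real.log_pos one_lt_two
  -- This is log t ≤ t - 1 at t = q/p; where p vanishes the right side is 0 and q ≥ 0 suffices.
  have key : ∀ ω, (p ω - q ω) / Real.log 2 ≤ p ω * Real.logb 2 (p ω / q ω) := by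
    intro ω
    rw [Real.logb, ← mul_div_assoc]
    refine div_le_div_of_nonneg_right ?_ h2.le
    by_cases h : p ω = 0
    · simp [h, hq ω]
    have hp' : 0 < p ω := lt_of_le_of_ne (hp ω) (Ne.symm h)
    have hq' : 0 < q ω := lt_of_le_of_ne (hq ω) (Ne.symm (hpq ω h))
    have := Real.log_le_sub_one_of_pos (div_pos hq' hp')
    have e : Real.log (p ω / q ω) = - Real.log (q ω / p ω) := by
      rw [← Real.log_inv, inv_div]
    rw [e]
    have h3 : p ω * (q ω / p ω) = q ω := by field_simp
    nlinarith
  refine le_trans ?_ (Finset.sum_le_sum fun ω _ => key ω)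
  rw [← Finset.sum_div, Finset.sum_sub_distrib]
  exact div_nonneg (by linarith) h2.le

/-- It is the divergence of the joint law of input and output from the one in which the channel is
replaced by its class average. -/
theorem classInfo_nonneg {Z Y : Type*} [Fintype Z] [Fintype Y] {P : Z → ℝ} {V : Z → Y → ℝ}
    {r : Z → Z → Prop} (hP : ∀ z, 0 ≤ P z) (hV0 : ∀ z y, 0 ≤ V z y) (hV : ∀ z, ∑ y, V z y = 1)
    (hr : ∀ z, r z z) : 0 ≤ classInfo P V r := by
  have := sum_mul_logb_div_nonneg (Ω := Z × Y) (p := fun ω => P ω.1 * V ω.1 ω.2)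
    (q := fun ω => P ω.1 * classKernel P V r ω.1 ω.2) (fun ω => mul_nonneg (hP _) (hV0 _ _))
    (fun ω => mul_nonneg (hP _) (classKernel_nonneg hP hV0 _ _)) ?_ ?_
  · rw [Fintype.sum_prod_type] at this
    refine this.trans_eq (Finset.sum_congr rfl fun z _ => Finset.sum_congr rfl fun y _ => ?_)
    by_cases hz : P z = 0
    · simp [hz]
    · rw [mul_div_mul_left _ _ hz]
  · intro ω h
    exact mul_ne_zero (left_ne_zero_of_mul h)
      (classKernel_pos hP hV0 hr (left_ne_zero_of_mul h) (right_ne_zero_of_mul h)).ne'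
  · rw [Fintype.sum_prod_type, Fintype.sum_prod_type]
    refine Finset.sum_le_sum fun z _ => ?_
    simp only [← Finset.mul_sum, hV]
    by_cases hz : P z = 0
    · simp [hz]
    · rw [sum_classKernel hP hV hr hz]

open Classical in
/-- A decoder that is right with probability `a` tests the channel `v` against a product channel `ρ`
whose output law takes only `D.card` values. -/
theorem mul_logb_sub_one_le {ℳ Y τ : Type*} [Fintype ℳ] [Nonempty ℳ] [Fintype Y] {n : ℕ}
    {v ρ : ℳ → Fin n → Y → ℝ} (hv0 : ∀ w j y, 0 ≤ v w j y) (hv : ∀ w j, ∑ y, v w j y = 1)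
    (hρ0 : ∀ w j y, 0 ≤ ρ w j y) (hρ : ∀ w j, ∑ y, ρ w j y = 1)
    (hvρ : ∀ w j y, v w j y ≠ 0 → ρ w j y ≠ 0) (T : ℳ → τ) (D : Finset τ) (hD : ∀ w, T w ∈ D)
    (hT : ∀ w w', T w = T w' → ρ w = ρ w') (dec : (Fin n → Y) → ℳ) :
    (∑ w, ∑ y with dec y = w, ∏ j, v w j (y j)) / Fintype.card ℳ *
        Real.logb 2 (Fintype.card ℳ / D.card) - 1 ≤
      (∑ w, ∑ j, ∑ y, v w j y * Real.logb 2 (v w j y / ρ w j y)) / Fintype.card ℳ := by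
  set M : ℝ := (Fintype.card ℳ : ℝ) with hM
  have hMpos : 0 < M := by simp [hM, Fintype.card_pos]
  have hDpos : 0 < (D.card : ℝ) := by
    have : D.Nonempty := ⟨_, hD (Classical.arbitrary ℳ)⟩
    exact_mod_cast this.card_pos
  -- The bound on the success probability of the decoder when the messages are sent through `ρ`.
  set b : ℝ := D.card / M with hb
  have hbpos : 0 < b := div_pos hDpos hMpos
  let p : ℳ × (Fin n → Y) → ℝ := fun ω => (∏ j, v ω.1 j (ω.2 j)) / M
  -- Reweighting the `ρ`-law by `c` gives total mass at most 1/2 + 1/2: success has probability at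
  -- most `b`, failure at most 1. The divergence inequality against this `q` then yields the
  -- logarithmic gain on success and the loss of one bit.
  let c : ℳ × (Fin n → Y) → ℝ := fun ω => if dec ω.2 = ω.1 then 1 / (2 * b) else 1 / 2
  let q : ℳ × (Fin n → Y) → ℝ := fun ω => (∏ j, ρ ω.1 j (ω.2 j)) / M * c ω
  have hc : ∀ ω, 0 < c ω := fun ω => by
    dsimp only [c]; split_ifs <;> positivity
  have hp0 : ∀ ω, 0 ≤ p ω := fun ω => div_nonneg (Finset.prod_nonneg fun j _ => hv0 _ _ _) hMpos.le
  have hsp : ∑ ω, p ω = 1 := by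
    rw [Fintype.sum_prod_type]
    simp only [p, ← Finset.sum_div]
    simp [sum_prod_eq_one (hv _), ← hM]
  have hG : ∑ w, ∑ y with dec y = w, ∏ j, ρ w j (y j) ≤ D.card := by
    -- One representative message per value of `T`. For each output only the decoded message
    -- contributes, and its `ρ`-law is among the laws of the representatives, each of total mass 1.
    let s : τ → ℳ := fun t => if h : ∃ w, T w = t then h.choose else Classical.arbitrary ℳ
    have hs : ∀ w, ρ (s (T w)) = ρ w := fun w => by
      have h : ∃ w', T w' = T w := ⟨w, rfl⟩
      have : s (T w) = h.choose := dif_pos h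
      rw [this]
      exact hT _ _ h.choose_spec
    calc ∑ w, ∑ y with dec y = w, ∏ j, ρ w j (y j)
        = ∑ y, ∏ j, ρ (dec y) j (y j) := by
          simp only [Finset.sum_filter]
          rw [Finset.sum_comm]
          simp
      _ ≤ ∑ y : Fin n → Y, ∑ t ∈ D, ∏ j, ρ (s t) j (y j) := by
          refine Finset.sum_le_sum fun y _ => ?_
          rw [← hs (dec y)]
          exact Finset.single_le_sum (f := fun t => ∏ j, ρ (s t) j (y j))
            (fun t _ => Finset.prod_nonneg fun j _ => hρ0 _ _ _) (hD (dec y))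
      _ = D.card := by
          rw [Finset.sum_comm]
          simp [sum_prod_eq_one (hρ _)]
  have hsq : ∑ ω, q ω ≤ ∑ ω, p ω := by
    have h1 : ∀ ω, q ω ≤ (if dec ω.2 = ω.1 then (∏ j, ρ ω.1 j (ω.2 j)) else 0) * (1 / (2 * b * M)) +
        (∏ j, ρ ω.1 j (ω.2 j)) * (1 / (2 * M)) := by
      intro ω
      have hpos : 0 ≤ ∏ j, ρ ω.1 j (ω.2 j) := Finset.prod_nonneg fun j _ => hρ0 _ _ _
      dsimp only [q, c]
      split_ifs
      · have : 0 ≤ (∏ j, ρ ω.1 j (ω.2 j)) * (1 / (2 * M)) := by positivity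
        have e : (∏ j, ρ ω.1 j (ω.2 j)) / M * (1 / (2 * b)) =
          (∏ j, ρ ω.1 j (ω.2 j)) * (1 / (2 * b * M)) := by field_simp
        linarith
      · apply le_of_eq; field_simp; ring
    refine (Finset.sum_le_sum fun ω _ => h1 ω).trans ?_
    rw [hsp, Finset.sum_add_distrib, ← Finset.sum_mul, ← Finset.sum_mul, Fintype.sum_prod_type,
      Fintype.sum_prod_type]
    simp only [sum_prod_eq_one (hρ _), ← Finset.sum_filter]
    have e1 : (D.card : ℝ) * (1 / (2 * b * M)) = 1 / 2 := by
      rw [hb]; field_simp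
    have e2 : (∑ _w : ℳ, (1 : ℝ)) * (1 / (2 * M)) = 1 / 2 := by
      simp only [Finset.sum_const, Finset.card_univ, nsmul_eq_mul, mul_one, ← hM]; field_simp
    have := mul_le_mul_of_nonneg_right hG (show (0 : ℝ) ≤ 1 / (2 * b * M) by positivity)
    linarith
  have hmain := sum_mul_logb_div_nonneg hp0
    (fun ω => mul_nonneg (div_nonneg (Finset.prod_nonneg fun j _ => hρ0 _ _ _) hMpos.le) (hc ω).le)
    (q := q) (fun ω h => by
      have hv' : ∏ j, v ω.1 j (ω.2 j) ≠ 0 := fun k => h (by simp [p, k])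
      refine mul_ne_zero (div_ne_zero (Finset.prod_ne_zero_iff.2 fun j hj => ?_) hMpos.ne') (hc ω).ne'
      exact hvρ _ _ _ (Finset.prod_ne_zero_iff.1 hv' j hj)) hsq
  have hterm : ∀ ω, p ω * Real.logb 2 (p ω / q ω) =
      (∏ j, v ω.1 j (ω.2 j)) * (∑ j, Real.logb 2 (v ω.1 j (ω.2 j) / ρ ω.1 j (ω.2 j))) / M -
        ((if dec ω.2 = ω.1 then (∏ j, v ω.1 j (ω.2 j)) else 0) / M * Real.logb 2 (M / D.card)
          - p ω) := by
    intro ω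
    by_cases h : ∏ j, v ω.1 j (ω.2 j) = 0
    · simp [p, h]
    have hv' : ∀ j, v ω.1 j (ω.2 j) ≠ 0 := fun j => Finset.prod_ne_zero_iff.1 h j (Finset.mem_univ _)
    have hρ' : ∀ j, ρ ω.1 j (ω.2 j) ≠ 0 := fun j => hvρ _ _ _ (hv' j)
    have hρp : ∏ j, ρ ω.1 j (ω.2 j) ≠ 0 := Finset.prod_ne_zero_iff.2 fun j _ => hρ' j
    have e1 : p ω / q ω = (∏ j, v ω.1 j (ω.2 j) / ρ ω.1 j (ω.2 j)) / c ω := by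
      rw [Finset.prod_div_distrib]
      have := (hc ω).ne'
      dsimp only [p, q]
      field_simp
    rw [e1, Real.logb_div (Finset.prod_ne_zero_iff.2 fun j _ => div_ne_zero (hv' j) (hρ' j))
      (hc ω).ne', Real.logb_prod _ _ fun j _ => div_ne_zero (hv' j) (hρ' j)]
    have e2 : Real.logb 2 (c ω) = (if dec ω.2 = ω.1 then Real.logb 2 (M / D.card) else 0) - 1 := by
      dsimp only [c]
      split_ifs
      · have : 1 / (2 * b) = (M / D.card) / 2 := by rw [hb]; field_simp
        rw [this, Real.logb_div (by positivity) (by norm_num), Real.logb_self_eq_one one_lt_two]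
      · rw [one_div, Real.logb_inv, Real.logb_self_eq_one one_lt_two]; ring
    rw [e2]
    dsimp only [p]
    split_ifs <;> ring
  simp_rw [hterm] at hmain
  rw [Finset.sum_sub_distrib, Finset.sum_sub_distrib, hsp, ← Finset.sum_mul, ← Finset.sum_div,
    ← Finset.sum_div, Fintype.sum_prod_type, Fintype.sum_prod_type] at hmain
  have e3 : ∀ w, ∑ y : Fin n → Y, (∏ j, v w j (y j)) *
      (∑ j, Real.logb 2 (v w j (y j) / ρ w j (y j))) =
        ∑ j, ∑ y, v w j y * Real.logb 2 (v w j y / ρ w j y) := by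
    intro w
    simp_rw [Finset.mul_sum]
    rw [Finset.sum_comm]
    exact Finset.sum_congr rfl fun j _ =>
      sum_prod_mul_apply (hv w) j (fun y => Real.logb 2 (v w j y / ρ w j y))
  simp only [e3, ← Finset.sum_filter] at hmain
  linarith

/-! ### The input distribution of a code -/

open Classical in
/-- The law of `g a` when `a` is uniform. -/
noncomputable def uniformMap {α β : Type*} [Fintype α] (g : α → β) (b : β) : ℝ :=
  (∑ a, if g a = b then 1 else 0) / Fintype.card α

theorem sum_uniformMap_mul {α β : Type*} [Fintype α] [Fintype β] (g : α → β) (h : β → ℝ) :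
    ∑ b, uniformMap g b * h b = (∑ a, h (g a)) / Fintype.card α := by
  classical
  simp only [uniformMap, div_mul_eq_mul_div, ← Finset.sum_div, Finset.sum_mul]
  rw [Finset.sum_comm]
  simp

theorem uniformMap_mem_stdSimplex {α β : Type*} [Fintype α] [Fintype β] [Nonempty α] (g : α → β) :
    uniformMap g ∈ stdSimplex ℝ β := by
  classical
  refine ⟨fun b => div_nonneg (Finset.sum_nonneg fun a _ => by split_ifs <;> simp) (by simp), ?_⟩
  have := sum_uniformMap_mul g fun _ => 1
  simpa using this

section CodeLaw

variable {X₁ X₂ X₃ Y : Type*} [Fintype X₁] [Fintype X₂] [Fintype X₃] [Fintype Y]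
  {n M₁ M₂ M₃ K₁ K₂ : ℕ} [NeZero n] [NeZero M₁] [NeZero M₂] [NeZero M₃]

/-- The input distribution of a code: `Q` is a uniform time index, `U₁` and `U₂` are the letters on
the links. -/
noncomputable def Code.law (c : Code X₁ X₂ X₃ Y n M₁ M₂ M₃ K₁ K₂) :
    InputLaw (Fin n) (Fin K₁) (Fin K₂) X₁ X₂ X₃ where
  pQ := uniformMap id
  p₁ j := uniformMap fun w => (c.enc₁ w j, c.link₁ w)
  p₂ j := uniformMap fun w => (c.enc₂ w j, c.link₂ w)
  p₃ j u₁ u₂ := uniformMap fun w => c.enc₃ u₁ u₂ w j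
  pQ_mem := uniformMap_mem_stdSimplex _
  p₁_mem _ := uniformMap_mem_stdSimplex _
  p₂_mem _ := uniformMap_mem_stdSimplex _
  p₃_mem _ _ _ := uniformMap_mem_stdSimplex _

/-- The letters at time `j` when the message triple is `w`. -/
def Code.letter {n M₁ M₂ M₃ K₁ K₂ : ℕ} (c : Code X₁ X₂ X₃ Y n M₁ M₂ M₃ K₁ K₂) (j : Fin n)
    (w : Fin M₁ × Fin M₂ × Fin M₃) : Fin n × Fin K₁ × Fin K₂ × X₁ × X₂ × X₃ :=
  (j, c.link₁ w.1, c.link₂ w.2.1, c.enc₁ w.1 j, c.enc₂ w.2.1 j,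
    c.enc₃ (c.link₁ w.1) (c.link₂ w.2.1) w.2.2 j)

omit [Fintype Y] in
-- The law factors as required because, at a fixed time, the pairs (x₁, u₁) and (x₂, u₂) come from
-- independent messages, and given the link letters x₃ depends only on the relay's own message.
theorem Code.sum_input_mul (c : Code X₁ X₂ X₃ Y n M₁ M₂ M₃ K₁ K₂)
    (h : Fin n × Fin K₁ × Fin K₂ × X₁ × X₂ × X₃ → ℝ) :
    ∑ z, c.law.input z * h z =
      (∑ j, ∑ w, h (c.letter j w)) / (Fintype.card (Fin M₁ × Fin M₂ × Fin M₃)) / n := by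
  let e : Fin n × Fin K₁ × Fin K₂ × X₁ × X₂ × X₃ ≃
      Fin n × (X₁ × Fin K₁) × (X₂ × Fin K₂) × X₃ :=
    { toFun := fun z => (z.1, (z.2.2.2.1, z.2.1), (z.2.2.2.2.1, z.2.2.1), z.2.2.2.2.2)
      invFun := fun z => (z.1, z.2.1.2, z.2.2.1.2, z.2.1.1, z.2.2.1.1, z.2.2.2)
      left_inv := fun _ => rfl
      right_inv := fun _ => rfl }
  let F : Fin n × (X₁ × Fin K₁) × (X₂ × Fin K₂) × X₃ → ℝ := fun z' => c.law.pQ z'.1 *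
    (c.law.p₁ z'.1 z'.2.1 * (c.law.p₂ z'.1 z'.2.2.1 *
      (c.law.p₃ z'.1 z'.2.1.2 z'.2.2.1.2 z'.2.2.2 * h (e.symm z'))))
  have h1 : ∀ z, c.law.input z * h z = F (e z) := fun z => by
    dsimp only [InputLaw.input, e, F, Equiv.coe_fn_mk, Equiv.coe_fn_symm_mk]
    ring
  have h2 : ∑ z', F z' = (∑ j, (∑ w₁, (∑ w₂, (∑ w₃, h (c.letter j (w₁, w₂, w₃))) /
      (M₃ : ℝ)) / (M₂ : ℝ)) / (M₁ : ℝ)) / (n : ℝ) := by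
    simp only [F]
    rw [Fintype.sum_prod_type]
    simp only [← Finset.mul_sum, Code.law]
    rw [sum_uniformMap_mul, Fintype.card_fin]
    refine congrArg (· / (n : ℝ)) (Finset.sum_congr rfl fun j _ => ?_)
    rw [Fintype.sum_prod_type]
    simp only [← Finset.mul_sum, id]
    rw [sum_uniformMap_mul, Fintype.card_fin]
    refine congrArg (· / (M₁ : ℝ)) (Finset.sum_congr rfl fun w₁ _ => ?_)
    rw [Fintype.sum_prod_type]
    simp only [← Finset.mul_sum]
    rw [sum_uniformMap_mul, Fintype.card_fin]
    refine congrArg (· / (M₂ : ℝ)) (Finset.sum_congr rfl fun w₂ _ => ?_)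
    rw [sum_uniformMap_mul, Fintype.card_fin]
    rfl
  rw [Fintype.sum_equiv e _ F h1, h2]
  simp only [Fintype.sum_prod_type, Fintype.card_prod, Fintype.card_fin, Nat.cast_mul,
    ← Finset.sum_div, div_div]
  congr 1
  ring

omit [Fintype Y] in
-- Ensures that the class averages used as test channels are genuine probability laws at every
-- letter that the code sends.
theorem Code.input_letter_ne_zero (c : Code X₁ X₂ X₃ Y n M₁ M₂ M₃ K₁ K₂) (j : Fin n)
    (w : Fin M₁ × Fin M₂ × Fin M₃) : c.law.input (c.letter j w) ≠ 0 := by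
  classical
  have h := c.sum_input_mul fun z => if z = c.letter j w then 1 else 0
  simp only [mul_ite, mul_one, mul_zero, Finset.sum_ite_eq', Finset.mem_univ, if_true] at h
  rw [h]
  have hn : (n : ℝ) ≠ 0 := by exact_mod_cast NeZero.ne n
  have hpos : 0 < ∑ j', ∑ w', (if c.letter j' w' = c.letter j w then (1 : ℝ) else 0) := by
    refine Finset.sum_pos' (fun _ _ => Finset.sum_nonneg fun _ _ => by split_ifs <;> simp)
      ⟨j, Finset.mem_univ _, Finset.sum_pos' (fun _ _ => by split_ifs <;> simp)
        ⟨w, Finset.mem_univ _, by simp⟩⟩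
  exact div_ne_zero (div_ne_zero hpos.ne' (by exact_mod_cast Fintype.card_ne_zero)) hn

end CodeLaw

/-! ### The converse for a single code -/

section Converse

variable {X₁ X₂ X₃ Y : Type*} [Fintype X₁] [Fintype X₂] [Fintype X₃] [Fintype Y]
  {n M₁ M₂ M₃ K₁ K₂ : ℕ}

omit [Fintype X₁] [Fintype X₂] [Fintype X₃] in
theorem Code.one_sub_errorProb [NeZero M₁] [NeZero M₂] [NeZero M₃] {W : X₁ → X₂ → X₃ → Y → ℝ}
    (hW : ∀ x₁ x₂ x₃, W x₁ x₂ x₃ ∈ stdSimplex ℝ Y) (c : Code X₁ X₂ X₃ Y n M₁ M₂ M₃ K₁ K₂) :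
    open Classical in
    1 - c.errorProb W = (∑ w, ∑ y with c.dec y = w,
      ∏ j, letterChannel (Fin n) (Fin K₁) (Fin K₂) W (c.letter j w) (y j)) /
        Fintype.card (Fin M₁ × Fin M₂ × Fin M₃) := by
  classical
  have h : c.errorProb W = (∑ w, ∑ y with c.dec y ≠ w,
      ∏ j, letterChannel (Fin n) (Fin K₁) (Fin K₂) W (c.letter j w) (y j)) /
        Fintype.card (Fin M₁ × Fin M₂ × Fin M₃) := by
    simp only [Fintype.sum_prod_type, Fintype.card_prod, Fintype.card_fin, Nat.cast_mul,
      ← mul_assoc, Code.errorProb]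
    rfl
  have hM : (Fintype.card (Fin M₁ × Fin M₂ × Fin M₃) : ℝ) ≠ 0 := by
    exact_mod_cast Fintype.card_ne_zero
  rw [h, eq_div_iff hM, sub_mul, div_mul_cancel₀ _ hM, sub_eq_iff_eq_add,
    ← Finset.sum_add_distrib]
  simp only [ne_eq, Finset.sum_filter_add_sum_filter_not]
  have : ∀ w : Fin M₁ × Fin M₂ × Fin M₃, ∑ y : Fin n → Y,
      ∏ j, letterChannel (Fin n) (Fin K₁) (Fin K₂) W (c.letter j w) (y j) = 1 := fun w =>
    sum_prod_eq_one (p := fun j => letterChannel (Fin n) (Fin K₁) (Fin K₂) W (c.letter j w))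
      fun j => (hW _ _ _).2
  simp [this]

/-- The number of values of the part of a message known under a pattern: the message itself
(if `x`), the letter on the link (if `u`), or nothing. -/
def sourceCount (u x : Bool) (M K : ℕ) : ℕ := if x then M else if u then K else 1

/-- The part of a message known under a pattern. -/
def sourcePart (u x : Bool) {M K : ℕ} (φ : Fin M → Fin K) (w : Fin M) : ℕ :=
  if x then w else if u then φ w else 0

theorem sourcePart_lt (u x : Bool) {M K : ℕ} (φ : Fin M → Fin K) (w : Fin M) :
    sourcePart u x φ w < sourceCount u x M K := by
  unfold sourcePart sourceCount
  split_ifs <;> simp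

theorem eq_of_sourcePart_eq {u x : Bool} {M K : ℕ} {φ : Fin M → Fin K} {w w' : Fin M}
    (h : sourcePart u x φ w = sourcePart u x φ w') (hux : x → u) :
    (x → w = w') ∧ (u → φ w = φ w') := by
  unfold sourcePart at h
  cases x <;> cases u <;> simp_all [Fin.ext_iff]
  have := Fin.ext h
  rw [this]

/-- The number of values of the part of the message triple known under a pattern. -/
def Pattern.count (f : Pattern) (M₁ M₂ M₃ K₁ K₂ : ℕ) : ℕ :=
  sourceCount f.u₁ f.x₁ M₁ K₁ * sourceCount f.u₂ f.x₂ M₂ K₂ * if f.x₃ then M₃ else 1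

/-- The test channel at time j is the class average at the letter sent. It depends only on the known
part `T` of the message triple, because equal known parts give letters that agree on the pattern at
every time. Averaging over time and messages turns the sum of divergences into n times the
single-letter information. -/
theorem Code.converse [NeZero n] [NeZero M₁] [NeZero M₂] [NeZero M₃] {W : X₁ → X₂ → X₃ → Y → ℝ}
    (hW : ∀ x₁ x₂ x₃, W x₁ x₂ x₃ ∈ stdSimplex ℝ Y) (c : Code X₁ X₂ X₃ Y n M₁ M₂ M₃ K₁ K₂)
    {f : Pattern} (hf : f.Valid) :
    (1 - c.errorProb W) *
        Real.logb 2 (((M₁ * M₂ * M₃ : ℕ) : ℝ) / (f.count M₁ M₂ M₃ K₁ K₂ : ℕ)) - 1 ≤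
      n * classInfo c.law.input (letterChannel (Fin n) (Fin K₁) (Fin K₂) W) f.Agree := by
  classical
  set V := letterChannel (Fin n) (Fin K₁) (Fin K₂) W with hVdef
  have hV0 : ∀ z y, 0 ≤ V z y := fun z y => (hW _ _ _).1 y
  have hV1 : ∀ z, ∑ y, V z y = 1 := fun z => (hW _ _ _).2
  have hP := c.law.input_nonneg
  let D : Finset (ℕ × ℕ × ℕ) := Finset.range (sourceCount f.u₁ f.x₁ M₁ K₁) ×ˢ
    Finset.range (sourceCount f.u₂ f.x₂ M₂ K₂) ×ˢ Finset.range (if f.x₃ then M₃ else 1)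
  let T : Fin M₁ × Fin M₂ × Fin M₃ → ℕ × ℕ × ℕ := fun w =>
    (sourcePart f.u₁ f.x₁ c.link₁ w.1, sourcePart f.u₂ f.x₂ c.link₂ w.2.1,
      if f.x₃ then (w.2.2 : ℕ) else 0)
  have hcard : D.card = f.count M₁ M₂ M₃ K₁ K₂ := by
    simp [D, Pattern.count, mul_assoc]
  have hTD : ∀ w, T w ∈ D := fun w => by
    simp only [T, D, Finset.mem_product, Finset.mem_range]
    refine ⟨sourcePart_lt _ _ _ _, sourcePart_lt _ _ _ _, ?_⟩
    split_ifs <;> simp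
  have hTρ : ∀ w w', T w = T w' → (fun j => classKernel c.law.input V f.Agree (c.letter j w)) =
      fun j => classKernel c.law.input V f.Agree (c.letter j w') := by
    intro w w' h
    have agree : ∀ w w', T w = T w' → ∀ j, f.Agree (c.letter j w) (c.letter j w') := by
      intro w w' h j
      simp only [T, Prod.mk.injEq] at h
      obtain ⟨a1, b1⟩ := eq_of_sourcePart_eq h.1 hf.1
      obtain ⟨a2, b2⟩ := eq_of_sourcePart_eq h.2.1 hf.2.1
      have h3 := h.2.2
      refine ⟨rfl, b1, b2, fun k => ?_, fun k => ?_, fun k => ?_⟩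
      · simp [Code.letter, a1 k]
      · simp [Code.letter, a2 k]
      · rw [if_pos k, if_pos k] at h3
        -- The relay's letter also depends on both link letters; validity guarantees that these are
        -- known whenever x₃ is.
        obtain ⟨k1, k2⟩ := hf.2.2.1 k
        simp [Code.letter, b1 k1, b2 k2, Fin.ext h3]
    exact funext fun j => classKernel_congr (r := f.Agree) (fun _ _ _ h h' => h.trans h')
      (agree w w' h j) (agree w' w h.symm j)
  have key := mul_logb_sub_one_le (v := fun w j => V (c.letter j w))
    (ρ := fun w j => classKernel c.law.input V f.Agree (c.letter j w))
    (fun w j y => hV0 _ _) (fun w j => hV1 _) (fun w j y => classKernel_nonneg hP hV0 _ _)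
    (fun w j => sum_classKernel hP hV1 (Pattern.Agree.refl f) (c.input_letter_ne_zero j w))
    (fun w j y h => (classKernel_pos hP hV0 (Pattern.Agree.refl f)
      (c.input_letter_ne_zero j w) h).ne') T D hTD hTρ c.dec
  rw [c.one_sub_errorProb hW, ← hcard]
  have e1 : ((M₁ * M₂ * M₃ : ℕ) : ℝ) = Fintype.card (Fin M₁ × Fin M₂ × Fin M₃) := by
    simp [mul_assoc]
  rw [e1]
  refine le_trans (le_of_eq ?_) (key.trans (le_of_eq ?_))
  · congr!
  have e2 : classInfo c.law.input V f.Agree = ∑ z, c.law.input z *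
      ∑ y, V z y * Real.logb 2 (V z y / classKernel c.law.input V f.Agree z y) := by
    simp only [classInfo, Finset.mul_sum, mul_assoc]
  have hn : (n : ℝ) ≠ 0 := by exact_mod_cast NeZero.ne n
  have e3 : ∀ x m : ℝ, x / m = n * (x / m / n) := fun x m => by field_simp
  rw [e2, c.sum_input_mul, ← e3]
  exact congrArg (· / _) Finset.sum_comm

/-- Rounding message counts up and link alphabets down both favour the inequality, so no correction
term arises. -/
theorem sourceRate_le_logb {u x : Bool} {n M K : ℕ} {R C : ℝ} (hM : (2 : ℝ) ^ (n * R) ≤ M)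
    (hK : (K : ℝ) ≤ 2 ^ (n * C)) (hK0 : K ≠ 0) :
    n * sourceRate u x R C ≤ Real.logb 2 (M / sourceCount u x M K) := by
  have hM0 : (0 : ℝ) < M := lt_of_lt_of_le (by positivity) hM
  have hMl : n * R ≤ Real.logb 2 M := (Real.le_logb_iff_rpow_le one_lt_two hM0).2 hM
  have hK0' : (0 : ℝ) < K := by positivity
  have hKl : Real.logb 2 K ≤ n * C := (Real.logb_le_iff_le_rpow one_lt_two hK0').2 hK
  unfold sourceRate sourceCount
  split_ifs
  · simp [div_self hM0.ne']
  · rw [Real.logb_div hM0.ne' hK0'.ne']; linarith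
  · simpa using hMl

theorem Pattern.rate_le_logb (f : Pattern) {n M₁ M₂ M₃ K₁ K₂ : ℕ} {C₁ C₂ R₁ R₂ R₃ : ℝ}
    (hM₁ : (2 : ℝ) ^ (n * R₁) ≤ M₁) (hM₂ : (2 : ℝ) ^ (n * R₂) ≤ M₂) (hM₃ : (2 : ℝ) ^ (n * R₃) ≤ M₃)
    (hK₁ : (K₁ : ℝ) ≤ 2 ^ (n * C₁)) (hK₂ : (K₂ : ℝ) ≤ 2 ^ (n * C₂)) (h₁ : K₁ ≠ 0) (h₂ : K₂ ≠ 0) :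
    n * f.rate C₁ C₂ R₁ R₂ R₃ ≤
      Real.logb 2 (((M₁ * M₂ * M₃ : ℕ) : ℝ) / (f.count M₁ M₂ M₃ K₁ K₂ : ℕ)) := by
  have p1 : (0 : ℝ) < M₁ := lt_of_lt_of_le (by positivity) hM₁
  have p2 : (0 : ℝ) < M₂ := lt_of_lt_of_le (by positivity) hM₂
  have p3 : (0 : ℝ) < M₃ := lt_of_lt_of_le (by positivity) hM₃
  have q1 : (0 : ℝ) < sourceCount f.u₁ f.x₁ M₁ K₁ := by
    unfold sourceCount; split_ifs <;> positivity
  have q2 : (0 : ℝ) < sourceCount f.u₂ f.x₂ M₂ K₂ := by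
    unfold sourceCount; split_ifs <;> positivity
  have q3 : (0 : ℝ) < ((if f.x₃ then M₃ else 1 : ℕ) : ℝ) := by
    split_ifs <;> positivity
  have e : ((M₁ * M₂ * M₃ : ℕ) : ℝ) / (f.count M₁ M₂ M₃ K₁ K₂ : ℕ) =
      M₁ / sourceCount f.u₁ f.x₁ M₁ K₁ * (M₂ / sourceCount f.u₂ f.x₂ M₂ K₂) *
        (M₃ / (if f.x₃ then M₃ else 1 : ℕ)) := by
    unfold Pattern.count
    push_cast
    field_simp
  rw [e, Real.logb_mul (by positivity) (by positivity), Real.logb_mul (by positivity)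
    (by positivity), Pattern.rate, mul_add, mul_add]
  refine add_le_add (add_le_add (sourceRate_le_logb hM₁ hK₁ h₁) (sourceRate_le_logb hM₂ hK₂ h₂)) ?_
  split_ifs
  · simp [div_self p3.ne']
  · simpa using (Real.le_logb_iff_rpow_le one_lt_two p3).2 hM₃

end Converse

/-! ### Asymptotics of the converse -/

theorem two_rpow_le_numMessages (R : ℝ) (n : ℕ) : (2 : ℝ) ^ ((n : ℝ) * R) ≤ numMessages R n :=
  Nat.le_ceil _

theorem numMessages_ne_zero (R : ℝ) (n : ℕ) : numMessages R n ≠ 0 :=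
  (Nat.ceil_pos.2 (by positivity)).ne'

instance (R : ℝ) (n : ℕ) : NeZero (numMessages R n) := ⟨numMessages_ne_zero R n⟩

theorem linkSize_le (C : ℝ) (n : ℕ) : (linkSize C n : ℝ) ≤ 2 ^ ((n : ℝ) * C) :=
  Nat.floor_le (by positivity)

theorem linkSize_ne_zero {C : ℝ} (hC : 0 ≤ C) (n : ℕ) : linkSize C n ≠ 0 :=
  (Nat.floor_pos.2 (Real.one_le_rpow one_le_two (by positivity))).ne'

/-- The capacity is not scaled along with the rate, and lR - C ≤ l(R - C) for C ≥ 0 and l ≤ 1. -/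
theorem sourceRate_mul_le {u x : Bool} {R C l : ℝ} (hC : 0 ≤ C) (hl : l ≤ 1) :
    sourceRate u x (l * R) C ≤ l * sourceRate u x R C := by
  unfold sourceRate
  split_ifs <;> nlinarith

theorem Pattern.rate_mul_le (f : Pattern) {C₁ C₂ R₁ R₂ R₃ l : ℝ} (hC₁ : 0 ≤ C₁) (hC₂ : 0 ≤ C₂)
    (hl : l ≤ 1) : f.rate C₁ C₂ (l * R₁) (l * R₂) (l * R₃) ≤ l * f.rate C₁ C₂ R₁ R₂ R₃ := by
  have h1 := sourceRate_mul_le (u := f.u₁) (x := f.x₁) (R := R₁) hC₁ hl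
  have h2 := sourceRate_mul_le (u := f.u₂) (x := f.x₂) (R := R₂) hC₂ hl
  unfold Pattern.rate
  split_ifs <;> nlinarith

/-- A set is contained in the closure of another one if all its points can be approached by
scaling. -/
theorem mem_closure_of_eventually_mul {S : Set (ℝ × ℝ × ℝ)} {R : ℝ × ℝ × ℝ}
    (h : ∀ᶠ l : ℝ in 𝓝[<] 1, (l * R.1, l * R.2.1, l * R.2.2) ∈ S) : R ∈ closure S := by
  refine mem_closure_of_tendsto (f := fun l : ℝ => (l * R.1, l * R.2.1, l * R.2.2)) ?_ h
  have : Continuous fun l : ℝ => (l * R.1, l * R.2.1, l * R.2.2) := by fun_prop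
  have h1 := this.tendsto 1
  simp only [one_mul] at h1
  exact h1.mono_left nhdsWithin_le_nhds

theorem eventually_mem_Ioo : ∀ᶠ l : ℝ in 𝓝[<] 1, l ∈ Set.Ioo (0 : ℝ) 1 :=
  Ioo_mem_nhdsLT one_pos

theorem Achievable.mem_rateRegion {X₁ X₂ X₃ Y : Type*} [Fintype X₁] [Fintype X₂] [Fintype X₃]
    [Fintype Y] {W : X₁ → X₂ → X₃ → Y → ℝ} (hW : ∀ x₁ x₂ x₃, W x₁ x₂ x₃ ∈ stdSimplex ℝ Y)
    {C₁ C₂ : ℝ} (hC₁ : 0 ≤ C₁) (hC₂ : 0 ≤ C₂) {R : ℝ × ℝ × ℝ} (hR : Achievable W C₁ C₂ R) :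
    R ∈ rateRegion W C₁ C₂ := by
  obtain ⟨⟨h1, h2, h3⟩, c, hc⟩ := hR
  refine mem_closure_of_eventually_mul ?_
  filter_upwards [eventually_mem_Ioo] with l hl
  refine ⟨⟨mul_nonneg hl.1.le h1, mul_nonneg hl.1.le h2, mul_nonneg hl.1.le h3⟩, ?_⟩
  -- For a positive rate the gap between l and 1 absorbs the error probability and the lost bit
  -- divided by n. A single block length then serves all patterns; those of rate at most 0 are
  -- settled by non-negativity of information.
  have hev : ∀ᶠ n : ℕ in Filter.atTop, ∀ f : Pattern, 0 < f.rate C₁ C₂ R.1 R.2.1 R.2.2 →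
      l * f.rate C₁ C₂ R.1 R.2.1 R.2.2 <
        (1 - (c n).errorProb W) * f.rate C₁ C₂ R.1 R.2.1 R.2.2 - 1 / (n : ℝ) := by
    rw [Filter.eventually_all]
    intro f
    by_cases hf : 0 < f.rate C₁ C₂ R.1 R.2.1 R.2.2
    · have ht : Filter.Tendsto (fun n : ℕ => (1 - (c n).errorProb W) *
          f.rate C₁ C₂ R.1 R.2.1 R.2.2 - 1 / (n : ℝ)) Filter.atTop
          (𝓝 ((1 - 0) * f.rate C₁ C₂ R.1 R.2.1 R.2.2 - 0)) :=
        ((tendsto_const_nhds.sub hc).mul_const _).sub tendsto_one_div_atTop_nhds_zero_nat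
      filter_upwards [ht.eventually_const_lt
        (u := l * f.rate C₁ C₂ R.1 R.2.1 R.2.2) (by nlinarith [hl.2])] with n hn _ using hn
    · exact Filter.Eventually.of_forall fun _ h => absurd h hf
  obtain ⟨n, hn, hn1⟩ := (hev.and (Filter.eventually_ge_atTop 1)).exists
  have : NeZero n := ⟨by omega⟩
  have hnpos : (0 : ℝ) < n := by exact_mod_cast hn1
  refine ⟨Fin n, Fin (linkSize C₁ n), Fin (linkSize C₂ n), inferInstance, inferInstance,
    inferInstance, (c n).law, ((c n).law.bounds_iff hW _ _ _ _ _).2 fun f hf => ?_⟩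
  refine (f.rate_mul_le hC₁ hC₂ hl.2.le).trans ?_
  by_cases hpos : 0 < f.rate C₁ C₂ R.1 R.2.1 R.2.2
  · have hconv := (c n).converse hW hf
    have hlog := f.rate_le_logb (two_rpow_le_numMessages R.1 n) (two_rpow_le_numMessages R.2.1 n)
      (two_rpow_le_numMessages R.2.2 n) (linkSize_le C₁ n) (linkSize_le C₂ n)
      (linkSize_ne_zero hC₁ n) (linkSize_ne_zero hC₂ n)
    have herr : 0 ≤ 1 - (c n).errorProb W := by
      rw [(c n).one_sub_errorProb hW]
      exact div_nonneg (Finset.sum_nonneg fun _ _ => Finset.sum_nonneg fun _ _ =>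
        Finset.prod_nonneg fun _ _ => (hW _ _ _).1 _) (by positivity)
    refine (hn f hpos).le.trans ?_
    have := (sub_le_sub_right (mul_le_mul_of_nonneg_left hlog herr) 1).trans hconv
    rw [← mul_le_mul_iff_right₀ hnpos]
    refine le_trans (le_of_eq ?_) this
    field_simp
  · refine (mul_nonpos_of_nonneg_of_nonpos hl.1.le (not_lt.1 hpos)).trans ?_
    exact classInfo_nonneg (c n).law.input_nonneg (fun _ => (hW _ _ _).1) (fun _ => (hW _ _ _).2)
      (Pattern.Agree.refl f)

/-! ### Random coding with independent letters -/

theorem exists_le_of_sum_mul_le {Ω : Type*} [Fintype Ω] {p F : Ω → ℝ} (hp : ∀ ω, 0 ≤ p ω)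
    (hp1 : ∑ ω, p ω = 1) {B : ℝ} (h : ∑ ω, p ω * F ω ≤ B) : ∃ ω, F ω ≤ B := by
  by_contra! hF
  have h0 : ∑ ω, p ω * (F ω - B) ≤ 0 := by
    simp only [mul_sub, Finset.sum_sub_distrib, ← Finset.sum_mul, hp1]; linarith
  have hnn : ∀ ω ∈ Finset.univ, 0 ≤ p ω * (F ω - B) := fun ω _ =>
    mul_nonneg (hp ω) (sub_nonneg.2 (hF ω).le)
  have hz := (Finset.sum_eq_zero_iff_of_nonneg hnn).1 (le_antisymm h0 (Finset.sum_nonneg hnn))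
  have : ∀ ω, p ω = 0 := fun ω =>
    (mul_eq_zero.1 (hz ω (Finset.mem_univ _))).resolve_right (sub_pos.2 (hF ω)).ne'
  simp [this] at hp1

theorem sum_prod_mul_sum_prod {Λ Y : Type*} [Fintype Λ] [Fintype Y] (n : ℕ) (μ : Λ → ℝ)
    (h : Λ → Y → ℝ) :
    ∑ cb : Fin n → Λ, (∏ j, μ (cb j)) * ∑ y : Fin n → Y, ∏ j, h (cb j) (y j) =
      (∑ l, μ l * ∑ y, h l y) ^ n := by
  have : ∀ cb : Fin n → Λ, (∏ j, μ (cb j)) * ∑ y : Fin n → Y, ∏ j, h (cb j) (y j) =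
      ∏ j, (μ (cb j) * ∑ y, h (cb j) y) := fun cb => by
    rw [sum_prod_apply (fun j => h (cb j)), Finset.prod_mul_distrib]
  simp_rw [this]
  rw [sum_prod_apply (fun _ l => μ l * ∑ y, h l y)]
  simp

open Classical in
-- Random coding in abstract form: an element of `Λ` holds one letter of all codewords, and the n
-- letters are drawn independently from `μ`. A decoding error means that the true message fails some
-- threshold (hypothesis `hA`, Chernoff) or that a wrong message passes the threshold of its pattern
-- (hypothesis `hB`, Markov). Both expectations factor over the letters.
theorem exists_codebook {ℳ Λ Z Y ι : Type*} [Fintype ℳ] [Nonempty ℳ] [Fintype Λ] [Fintype Y]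
    (n : ℕ) {μ : Λ → ℝ} (hμ0 : ∀ l, 0 ≤ μ l) (hμ1 : ∑ l, μ l = 1) (letter : Λ → ℳ → Z)
    {V : Z → Y → ℝ} (hV0 : ∀ z y, 0 ≤ V z y) (F : Finset ι) (L : ι → Z → Y → ℝ) (τ θ A : ι → ℝ)
    (hθ : ∀ f ∈ F, 0 ≤ θ f)
    (hA : ∀ f ∈ F, ∀ w, ∑ l, μ l * ∑ y, V (letter l w) y *
      Real.exp (θ f * (τ f - L f (letter l w) y)) ≤ A f)
    (pat : ℳ → ℳ → ι) (hpat : ∀ w w', w' ≠ w → pat w w' ∈ F)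
    (hB : ∀ w w', w' ≠ w → ∑ l, μ l * ∑ y, V (letter l w) y *
      (if V (letter l w') y = 0 then 0 else Real.exp (L (pat w w') (letter l w') y)) ≤ 1) :
    ∃ (cb : Fin n → Λ) (dec : (Fin n → Y) → ℳ),
      ∑ w, ∑ y with dec y ≠ w, ∏ j, V (letter (cb j) w) (y j) ≤
        ∑ w, (∑ f ∈ F, A f ^ n + ∑ w' with w' ≠ w, Real.exp (-(n * τ (pat w w')))) := by
  -- Candidates under which the output is impossible are rejected explicitly, because an `L` given
  -- by a logarithm has a meaningless default value there; this matches the zero in `hB`.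
  let pass : (Fin n → Λ) → ι → ℳ → (Fin n → Y) → Prop := fun cb f w y =>
    (∀ j, V (letter (cb j) w) (y j) ≠ 0) ∧ n * τ f ≤ ∑ j, L f (letter (cb j) w) (y j)
  let good : (Fin n → Λ) → ℳ → (Fin n → Y) → Prop := fun cb w y => ∀ f ∈ F, pass cb f w y
  let dec : (Fin n → Λ) → (Fin n → Y) → ℳ := fun cb y =>
    if h : ∃ w, good cb w y then h.choose else Classical.arbitrary ℳ
  let g : ι → Z → Y → ℝ := fun f z y => if V z y = 0 then 0 else Real.exp (L f z y)
  have hg : ∀ f z y, 0 ≤ g f z y := fun f z y => by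
    dsimp only [g]; split_ifs
    exacts [le_rfl, (Real.exp_pos _).le]
  let a : ℳ → ι → Λ → Y → ℝ := fun w f l y =>
    V (letter l w) y * Real.exp (θ f * (τ f - L f (letter l w) y))
  let b : ℳ → ℳ → Λ → Y → ℝ := fun w w' l y =>
    V (letter l w) y * g (pat w w') (letter l w') y
  have ha0 : ∀ w f l y, 0 ≤ a w f l y := fun w f l y => mul_nonneg (hV0 _ _) (Real.exp_pos _).le
  have hb0 : ∀ w w' l y, 0 ≤ b w w' l y := fun w w' l y => mul_nonneg (hV0 _ _) (hg _ _ _)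
  -- The union bound holds pointwise: if the true message is good, the decoder has chosen another
  -- good one, so that one's term in the second sum dominates; otherwise the failed threshold's term
  -- in the first sum does.
  have hpoint : ∀ cb w y, (if dec cb y ≠ w then ∏ j, V (letter (cb j) w) (y j) else 0) ≤
      ∑ f ∈ F, ∏ j, a w f (cb j) (y j) +
        ∑ w' with w' ≠ w, Real.exp (-(n * τ (pat w w'))) * ∏ j, b w w' (cb j) (y j) := by
    intro cb w y
    have hn1 : ∀ f ∈ F, 0 ≤ ∏ j, a w f (cb j) (y j) := fun f _ =>
      Finset.prod_nonneg fun j _ => ha0 _ _ _ _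
    have hn2 : ∀ w' ∈ Finset.univ.filter (· ≠ w),
        0 ≤ Real.exp (-(n * τ (pat w w'))) * ∏ j, b w w' (cb j) (y j) := fun w' _ =>
      mul_nonneg (Real.exp_pos _).le (Finset.prod_nonneg fun j _ => hb0 _ _ _ _)
    have hV' : 0 ≤ ∏ j, V (letter (cb j) w) (y j) := Finset.prod_nonneg fun j _ => hV0 _ _
    split_ifs with hdec
    swap
    · exact add_nonneg (Finset.sum_nonneg hn1) (Finset.sum_nonneg hn2)
    by_cases hz : ∏ j, V (letter (cb j) w) (y j) = 0
    · rw [hz]; exact add_nonneg (Finset.sum_nonneg hn1) (Finset.sum_nonneg hn2)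
    have hz' : ∀ j, V (letter (cb j) w) (y j) ≠ 0 := fun j =>
      Finset.prod_ne_zero_iff.1 hz j (Finset.mem_univ _)
    by_cases hw : good cb w y
    · have hex : ∃ w, good cb w y := ⟨w, hw⟩
      have hd : dec cb y = hex.choose := dif_pos hex
      have hgood : good cb (dec cb y) y := hd ▸ hex.choose_spec
      obtain ⟨hp1, hp2⟩ := hgood _ (hpat w _ hdec)
      refine le_trans ?_ (le_add_of_nonneg_left (Finset.sum_nonneg hn1))
      refine le_trans ?_ (Finset.single_le_sum hn2
        (Finset.mem_filter.2 ⟨Finset.mem_univ (dec cb y), hdec⟩))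
      simp only [b, g, Finset.prod_mul_distrib, if_neg (hp1 _)]
      rw [← Real.exp_sum, mul_left_comm, ← Real.exp_add]
      exact le_mul_of_one_le_right hV' (Real.one_le_exp (by linarith))
    · have : ∃ f ∈ F, ∑ j, L f (letter (cb j) w) (y j) < n * τ f := by
        simp only [good, pass, not_forall, not_and, not_le] at hw
        obtain ⟨f, hf, h⟩ := hw
        exact ⟨f, hf, h hz'⟩
      obtain ⟨f, hf, hlt⟩ := this
      refine le_trans ?_ (le_add_of_nonneg_right (Finset.sum_nonneg hn2))
      refine le_trans ?_ (Finset.single_le_sum hn1 hf)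
      simp only [a, Finset.prod_mul_distrib]
      rw [← Real.exp_sum, ← Finset.mul_sum]
      refine le_mul_of_one_le_right hV' (Real.one_le_exp (mul_nonneg (hθ f hf) ?_))
      simp only [Finset.sum_sub_distrib, Finset.sum_const, Finset.card_univ, Fintype.card_fin,
        nsmul_eq_mul]
      linarith
  suffices h : ∑ cb : Fin n → Λ, (∏ j, μ (cb j)) *
      (∑ w, ∑ y with dec cb y ≠ w, ∏ j, V (letter (cb j) w) (y j)) ≤
        ∑ w, (∑ f ∈ F, A f ^ n + ∑ w' with w' ≠ w, Real.exp (-(n * τ (pat w w')))) by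
    obtain ⟨cb, hcb⟩ := exists_le_of_sum_mul_le
      (fun cb => Finset.prod_nonneg fun j _ => hμ0 (cb j)) (sum_prod_eq_one fun _ => hμ1) h
    exact ⟨cb, dec cb, hcb⟩
  simp only [Finset.sum_filter (s := (Finset.univ : Finset (Fin n → Y)))]
  have hstep : ∀ cb : Fin n → Λ, (∏ j, μ (cb j)) *
      (∑ w, ∑ y, if dec cb y ≠ w then ∏ j, V (letter (cb j) w) (y j) else 0) ≤
      ∑ w, (∑ f ∈ F, (∏ j, μ (cb j)) * ∑ y : Fin n → Y, ∏ j, a w f (cb j) (y j) +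
        ∑ w' with w' ≠ w, Real.exp (-(n * τ (pat w w'))) *
          ((∏ j, μ (cb j)) * ∑ y : Fin n → Y, ∏ j, b w w' (cb j) (y j))) := by
    intro cb
    rw [Finset.mul_sum]
    refine Finset.sum_le_sum fun w _ => ?_
    refine (mul_le_mul_of_nonneg_left (Finset.sum_le_sum fun y _ => hpoint cb w y)
      (Finset.prod_nonneg fun j _ => hμ0 (cb j))).trans (le_of_eq ?_)
    rw [Finset.sum_add_distrib, mul_add, Finset.sum_comm, Finset.mul_sum]
    congr 1
    rw [Finset.sum_comm, Finset.mul_sum]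
    refine Finset.sum_congr rfl fun w' _ => ?_
    rw [← Finset.mul_sum]
    ring
  refine (Finset.sum_le_sum fun cb _ => hstep cb).trans ?_
  rw [Finset.sum_comm]
  refine Finset.sum_le_sum fun w _ => ?_
  rw [Finset.sum_add_distrib, Finset.sum_comm]
  refine add_le_add (Finset.sum_le_sum fun f hf => ?_) ?_
  · rw [sum_prod_mul_sum_prod n μ (a w f)]
    exact pow_le_pow_left₀ (Finset.sum_nonneg fun l _ => mul_nonneg (hμ0 l)
      (Finset.sum_nonneg fun y _ => ha0 _ _ _ _)) (hA f hf w) n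
  · rw [Finset.sum_comm]
    refine Finset.sum_le_sum fun w' hw' => ?_
    rw [← Finset.mul_sum, sum_prod_mul_sum_prod n μ (b w w')]
    refine mul_le_of_le_one_right (Real.exp_pos _).le (pow_le_one₀ (Finset.sum_nonneg fun l _ =>
      mul_nonneg (hμ0 l) (Finset.sum_nonneg fun y _ => hb0 _ _ _ _)) ?_)
    exact hB w w' (Finset.mem_filter.1 hw').2

/-- Chernoff's bound: a sum of exponentials of negative mean drops below its value at zero. -/
theorem exists_sum_mul_exp_lt_one {Ω : Type*} [Fintype Ω] {p x : Ω → ℝ} (hp1 : ∑ ω, p ω = 1)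
    (hx : ∑ ω, p ω * x ω < 0) : ∃ θ, 0 ≤ θ ∧ ∑ ω, p ω * Real.exp (θ * x ω) < 1 := by
  have hd : HasDerivAt (fun θ : ℝ => ∑ ω, p ω * Real.exp (θ * x ω)) (∑ ω, p ω * x ω) 0 := by
    refine HasDerivAt.fun_sum fun ω _ => ?_
    have := (((hasDerivAt_id (0 : ℝ)).mul_const (x ω)).exp).const_mul (p ω)
    simpa using this
  have hlt : ∀ᶠ θ : ℝ in 𝓝[>] 0, ∑ ω, p ω * Real.exp (θ * x ω) < 1 := by
    have h := hd.hasDerivWithinAt (s := Set.Ioi 0)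
    have h2 := h.limsup_slope_le' (by simp) hx
    filter_upwards [h2, self_mem_nhdsWithin] with θ h1 (hθ : 0 < θ)
    simp only [slope_def_field, zero_mul, Real.exp_zero, mul_one, hp1, sub_zero] at h1
    have := (div_neg_iff.1 h1)
    rcases this with h | h
    · linarith [h.2]
    · linarith [h.1]
  obtain ⟨θ, h1, h2⟩ := (hlt.and self_mem_nhdsWithin).exists
  exact ⟨θ, le_of_lt h2, h1⟩

/-! ### Superposition codebooks -/

/-- An input distribution with `p(xᵢ, uᵢ | q)` written as `p(uᵢ | q) p(xᵢ | uᵢ, q)`. -/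
structure FactoredLaw (Q U₁ U₂ X₁ X₂ X₃ : Type*) [Fintype Q] [Fintype U₁] [Fintype U₂]
    [Fintype X₁] [Fintype X₂] [Fintype X₃] where
  pQ : Q → ℝ
  a₁ : Q → U₁ → ℝ
  a₂ : Q → U₂ → ℝ
  b₁ : Q → U₁ → X₁ → ℝ
  b₂ : Q → U₂ → X₂ → ℝ
  p₃ : Q → U₁ → U₂ → X₃ → ℝ
  pQ_mem : pQ ∈ stdSimplex ℝ Q
  a₁_mem : ∀ q, a₁ q ∈ stdSimplex ℝ U₁
  a₂_mem : ∀ q, a₂ q ∈ stdSimplex ℝ U₂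
  b₁_mem : ∀ q u, b₁ q u ∈ stdSimplex ℝ X₁
  b₂_mem : ∀ q u, b₂ q u ∈ stdSimplex ℝ X₂
  p₃_mem : ∀ q u₁ u₂, p₃ q u₁ u₂ ∈ stdSimplex ℝ X₃

theorem exists_conditional {X U : Type*} [Fintype X] [Fintype U] [Nonempty X] {p : X × U → ℝ}
    (hp : p ∈ stdSimplex ℝ (X × U)) : ∃ (a : U → ℝ) (b : U → X → ℝ), a ∈ stdSimplex ℝ U ∧
      (∀ u, b u ∈ stdSimplex ℝ X) ∧ ∀ x u, p (x, u) = a u * b u x := by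
  classical
  obtain ⟨hp0, hp1⟩ := hp
  obtain ⟨x₀⟩ := ‹Nonempty X›
  let a : U → ℝ := fun u => ∑ x, p (x, u)
  have ha : ∀ u, 0 ≤ a u := fun u => Finset.sum_nonneg fun x _ => hp0 _
  -- Where the marginal vanishes the conditional law is arbitrary; a point mass keeps it in the
  -- simplex.
  refine ⟨a, fun u x => if a u = 0 then (if x = x₀ then 1 else 0) else p (x, u) / a u,
    ⟨ha, ?_⟩, fun u => ⟨fun x => ?_, ?_⟩, fun x u => ?_⟩
  · rw [Fintype.sum_prod_type_right] at hp1
    exact hp1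
  · dsimp only
    split_ifs
    exacts [zero_le_one, le_rfl, div_nonneg (hp0 _) (ha u)]
  · by_cases h : a u = 0
    · simp [h]
    · simp only [h, if_false, ← Finset.sum_div]
      exact div_self h
  · dsimp only
    split_ifs with h1 h2
    · rw [h1, zero_mul]
      exact (Finset.sum_eq_zero_iff_of_nonneg fun x _ => hp0 (x, u)).1 h1 x (Finset.mem_univ _)
    · rw [h1, zero_mul]
      exact (Finset.sum_eq_zero_iff_of_nonneg fun x _ => hp0 (x, u)).1 h1 x (Finset.mem_univ _)
    · rw [mul_div_cancel₀ _ h1]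

section Coupling

variable {A : Type*} [Fintype A]

open Classical in
/-- The law of a letter given another one, which is the same (if `s`) or independent. -/
noncomputable def condLetter (s : Bool) (p : A → ℝ) (a a' : A) : ℝ :=
  if s then (if a = a' then 1 else 0) else p a

theorem sum_condLetter (s : Bool) {p : A → ℝ} (hp : ∑ a, p a = 1) (a' : A) :
    ∑ a, condLetter s p a a' = 1 := by
  classical
  cases s
  · simpa [condLetter] using hp
  · simp only [condLetter, if_true]
    rw [Finset.sum_ite_eq' Finset.univ a' fun _ => (1 : ℝ), if_pos (Finset.mem_univ _)]

omit [Fintype A] in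
theorem condLetter_mul {s : Bool} {p p' : A → ℝ} {a a' : A} (h : s → a = a' ∧ p = p') :
    condLetter s p a a' * (if s then p' a' else 1) = p a := by
  cases s
  · simp [condLetter]
  · obtain ⟨rfl, rfl⟩ := h rfl
    simp [condLetter]

omit [Fintype A] in
theorem eq_of_condLetter_ne_zero {s : Bool} {p : A → ℝ} {a a' : A}
    (h : condLetter s p a a' ≠ 0) (hs : s) : a = a' := by
  by_contra hne
  simp [condLetter, hs, hne] at h

/-- Two entries of an independent family are either the same entry or independent. This is the only
probabilistic fact needed for the law of a pair of superposition codewords. -/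
theorem sum_prod_mul_pair {ι : Type*} [Fintype ι] [DecidableEq ι] {p : ι → A → ℝ}
    (hp : ∀ i, ∑ a, p i a = 1) (i j : ι) (g : A → A → ℝ) :
    ∑ f : ι → A, (∏ i, p i (f i)) * g (f i) (f j) =
      ∑ t : A × A, p j t.2 * condLetter (decide (i = j)) (p i) t.1 t.2 * g t.1 t.2 := by
  classical
  rw [Fintype.sum_prod_type]
  by_cases h : i = j
  · subst h
    rw [sum_prod_mul_apply hp i (fun a => g a a)]
    simp [condLetter]
  · rw [sum_prod_mul_apply₂ hp h]
    simp [condLetter, h, mul_comm]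

end Coupling

namespace FactoredLaw

variable {Q U₁ U₂ X₁ X₂ X₃ Y : Type*} [Fintype Q] [Fintype U₁] [Fintype U₂]
    [Fintype X₁] [Fintype X₂] [Fintype X₃] [Fintype Y] (G : FactoredLaw Q U₁ U₂ X₁ X₂ X₃)

/-- The mass function of `(q, u₁, u₂, x₁, x₂, x₃)`. -/
def mass (z : Q × U₁ × U₂ × X₁ × X₂ × X₃) : ℝ :=
  G.pQ z.1 * (G.a₁ z.1 z.2.1 * (G.a₂ z.1 z.2.2.1 * (G.b₁ z.1 z.2.1 z.2.2.2.1 *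
    (G.b₂ z.1 z.2.2.1 z.2.2.2.2.1 * G.p₃ z.1 z.2.1 z.2.2.1 z.2.2.2.2.2))))

theorem mass_nonneg (z) : 0 ≤ G.mass z :=
  mul_nonneg (G.pQ_mem.1 _) (mul_nonneg ((G.a₁_mem _).1 _) (mul_nonneg ((G.a₂_mem _).1 _)
    (mul_nonneg ((G.b₁_mem _ _).1 _) (mul_nonneg ((G.b₂_mem _ _).1 _) ((G.p₃_mem _ _ _).1 _)))))

theorem sum_mass : ∑ z, G.mass z = 1 := by
  simp only [mass, Fintype.sum_prod_type, ← Finset.mul_sum, (G.p₃_mem _ _ _).2, (G.b₂_mem _ _).2,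
    (G.b₁_mem _ _).2, (G.a₂_mem _).2, (G.a₁_mem _).2, G.pQ_mem.2, mul_one]

theorem _root_.RelayMAC.InputLaw.exists_factoredLaw [Nonempty X₁] [Nonempty X₂]
    (P : InputLaw Q U₁ U₂ X₁ X₂ X₃) :
    ∃ G : FactoredLaw Q U₁ U₂ X₁ X₂ X₃, G.mass = P.input := by
  choose a₁ b₁ ha₁ hb₁ h₁ using fun q => exists_conditional (P.p₁_mem q)
  choose a₂ b₂ ha₂ hb₂ h₂ using fun q => exists_conditional (P.p₂_mem q)
  refine ⟨⟨P.pQ, a₁, a₂, b₁, b₂, P.p₃, P.pQ_mem, ha₁, ha₂, hb₁, hb₂, P.p₃_mem⟩, ?_⟩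
  funext ⟨q, u₁, u₂, x₁, x₂, x₃⟩
  simp only [mass, InputLaw.input, h₁, h₂]
  ring

/-- The conditional law of one input given another one that shares the coordinates in the pattern
and is otherwise independent. -/
noncomputable def cond (f : Pattern) (z z' : Q × U₁ × U₂ × X₁ × X₂ × X₃) : ℝ :=
  condLetter true G.pQ z.1 z'.1 * (condLetter f.u₁ (G.a₁ z.1) z.2.1 z'.2.1 *
    (condLetter f.u₂ (G.a₂ z.1) z.2.2.1 z'.2.2.1 *
      (condLetter f.x₁ (G.b₁ z.1 z.2.1) z.2.2.2.1 z'.2.2.2.1 *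
        (condLetter f.x₂ (G.b₂ z.1 z.2.2.1) z.2.2.2.2.1 z'.2.2.2.2.1 *
          condLetter f.x₃ (G.p₃ z.1 z.2.1 z.2.2.1) z.2.2.2.2.2 z'.2.2.2.2.2))))

theorem sum_cond (f : Pattern) (z') : ∑ z, G.cond f z z' = 1 := by
  simp only [cond, Fintype.sum_prod_type, ← Finset.mul_sum,
    sum_condLetter _ (G.p₃_mem _ _ _).2, sum_condLetter _ (G.b₂_mem _ _).2,
    sum_condLetter _ (G.b₁_mem _ _).2, sum_condLetter _ (G.a₂_mem _).2,
    sum_condLetter _ (G.a₁_mem _).2, sum_condLetter _ G.pQ_mem.2, mul_one]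

/-- The probability of the coordinates in the pattern. -/
def sharedMass (f : Pattern) (z : Q × U₁ × U₂ × X₁ × X₂ × X₃) : ℝ :=
  G.pQ z.1 * ((if f.u₁ then G.a₁ z.1 z.2.1 else 1) * ((if f.u₂ then G.a₂ z.1 z.2.2.1 else 1) *
    ((if f.x₁ then G.b₁ z.1 z.2.1 z.2.2.2.1 else 1) *
      ((if f.x₂ then G.b₂ z.1 z.2.2.1 z.2.2.2.2.1 else 1) *
        (if f.x₃ then G.p₃ z.1 z.2.1 z.2.2.1 z.2.2.2.2.2 else 1)))))

open Classical in
-- Bayes' rule, one coordinate at a time. Validity matters: a shared coordinate has shared parents,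
-- so its conditional law is the same for both inputs.
theorem cond_mul_sharedMass {f : Pattern} (hf : f.Valid) (z z' : Q × U₁ × U₂ × X₁ × X₂ × X₃) :
    G.cond f z z' * G.sharedMass f z' = if f.Agree z z' then G.mass z else 0 := by
  obtain ⟨q, u₁, u₂, x₁, x₂, x₃⟩ := z
  obtain ⟨q', u₁', u₂', x₁', x₂', x₃'⟩ := z'
  by_cases h : f.Agree (q, u₁, u₂, x₁, x₂, x₃) (q', u₁', u₂', x₁', x₂', x₃')
  · rw [if_pos h]
    obtain ⟨h0, h1, h2, h3, h4, h5⟩ := h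
    obtain ⟨v1, v2, v3, -⟩ := hf
    dsimp only at h0 h1 h2 h3 h4 h5
    subst h0
    have k1 := condLetter_mul (s := f.u₁) (p := G.a₁ q) (p' := G.a₁ q) (a := u₁) (a' := u₁')
      fun k => ⟨h1 k, rfl⟩
    have k2 := condLetter_mul (s := f.u₂) (p := G.a₂ q) (p' := G.a₂ q) (a := u₂) (a' := u₂')
      fun k => ⟨h2 k, rfl⟩
    have k3 := condLetter_mul (s := f.x₁) (p := G.b₁ q u₁) (p' := G.b₁ q u₁') (a := x₁) (a' := x₁')
      fun k => ⟨h3 k, by rw [h1 (v1 k)]⟩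
    have k4 := condLetter_mul (s := f.x₂) (p := G.b₂ q u₂) (p' := G.b₂ q u₂') (a := x₂) (a' := x₂')
      fun k => ⟨h4 k, by rw [h2 (v2 k)]⟩
    have k5 := condLetter_mul (s := f.x₃) (p := G.p₃ q u₁ u₂) (p' := G.p₃ q u₁' u₂') (a := x₃) (a' := x₃')
      fun k =>
      ⟨h5 k, by rw [h1 (v3 k).1, h2 (v3 k).2]⟩
    dsimp only [cond, sharedMass, mass]
    rw [← k1, ← k2, ← k3, ← k4, ← k5]
    simp only [condLetter, if_true]
    ring
  · rw [if_neg h]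
    have : G.cond f (q, u₁, u₂, x₁, x₂, x₃) (q', u₁', u₂', x₁', x₂', x₃') = 0 := by
      by_contra hne
      simp only [cond, mul_ne_zero_iff] at hne
      obtain ⟨h0, h1, h2, h3, h4, h5⟩ := hne
      exact h ⟨eq_of_condLetter_ne_zero h0 rfl, eq_of_condLetter_ne_zero h1,
        eq_of_condLetter_ne_zero h2, eq_of_condLetter_ne_zero h3, eq_of_condLetter_ne_zero h4,
        eq_of_condLetter_ne_zero h5⟩
    rw [this, zero_mul]

omit [Fintype Y] in
-- The bridge between information and random coding: averaging over a class amounts to resampling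
-- the unshared coordinates, which is how the codewords of two message triples are related.
theorem classKernel_mass {f : Pattern} (hf : f.Valid) (V : Q × U₁ × U₂ × X₁ × X₂ × X₃ → Y → ℝ)
    {z : Q × U₁ × U₂ × X₁ × X₂ × X₃} (hz : G.mass z ≠ 0) (y : Y) :
    classKernel G.mass V f.Agree z y = ∑ z', G.cond f z' z * V z' y := by
  classical
  have h1 : classMass G.mass f.Agree z = G.sharedMass f z := by
    rw [classMass, Finset.sum_filter, ← one_mul (G.sharedMass f z), ← G.sum_cond f z,
      Finset.sum_mul]
    exact Finset.sum_congr rfl fun z' _ => (G.cond_mul_sharedMass hf z' z).symm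
  have h2 : classOut G.mass V f.Agree z y =
      (∑ z', G.cond f z' z * V z' y) * G.sharedMass f z := by
    rw [classOut, Finset.sum_filter, Finset.sum_mul]
    refine Finset.sum_congr rfl fun z' _ => ?_
    rw [mul_right_comm, G.cond_mul_sharedMass hf z' z]
    split_ifs <;> simp
  have h3 := classMass_pos G.mass_nonneg (Pattern.Agree.refl f) hz
  rw [h1] at h3
  rw [classKernel, h1, h2, mul_div_cancel_right₀ _ h3.ne']

variable {M₁ M₂ M₃ K₁ K₂ : ℕ} (φ₁ : Fin M₁ → Fin K₁) (φ₂ : Fin M₂ → Fin K₂)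

variable (Q U₁ U₂ X₁ X₂ X₃ M₁ M₂ M₃ K₁ K₂) in
/-- One letter of each codeword. -/
abbrev LetterBook : Type _ :=
  Q × (Fin K₁ → U₁) × (Fin K₂ → U₂) × (Fin M₁ → X₁) × (Fin M₂ → X₂) ×
    (Fin K₁ × Fin K₂ × Fin M₃ → X₃)

/-- The probability of a choice of letters in superposition coding. -/
def bookMass (l : LetterBook Q U₁ U₂ X₁ X₂ X₃ M₁ M₂ M₃ K₁ K₂) : ℝ :=
  G.pQ l.1 * ((∏ v, G.a₁ l.1 (l.2.1 v)) * ((∏ v, G.a₂ l.1 (l.2.2.1 v)) *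
    ((∏ w, G.b₁ l.1 (l.2.1 (φ₁ w)) (l.2.2.2.1 w)) *
      ((∏ w, G.b₂ l.1 (l.2.2.1 (φ₂ w)) (l.2.2.2.2.1 w)) *
        ∏ i : Fin K₁ × Fin K₂ × Fin M₃, G.p₃ l.1 (l.2.1 i.1) (l.2.2.1 i.2.1) (l.2.2.2.2.2 i)))))

/-- The letters that belong to a message triple. -/
def bookLetter (l : LetterBook Q U₁ U₂ X₁ X₂ X₃ M₁ M₂ M₃ K₁ K₂) (w : Fin M₁ × Fin M₂ × Fin M₃) :
    Q × U₁ × U₂ × X₁ × X₂ × X₃ :=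
  (l.1, l.2.1 (φ₁ w.1), l.2.2.1 (φ₂ w.2.1), l.2.2.2.1 w.1, l.2.2.2.2.1 w.2.1,
    l.2.2.2.2.2 (φ₁ w.1, φ₂ w.2.1, w.2.2))

/-- The coordinates shared by the codewords of two message triples. -/
def pattern (w w' : Fin M₁ × Fin M₂ × Fin M₃) : Pattern where
  u₁ := decide (φ₁ w.1 = φ₁ w'.1)
  x₁ := decide (w.1 = w'.1)
  u₂ := decide (φ₂ w.2.1 = φ₂ w'.2.1)
  x₂ := decide (w.2.1 = w'.2.1)
  x₃ := decide ((φ₁ w.1, φ₂ w.2.1, w.2.2) = (φ₁ w'.1, φ₂ w'.2.1, w'.2.2))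

theorem pattern_valid {w w' : Fin M₁ × Fin M₂ × Fin M₃} (h : w' ≠ w) :
    (pattern φ₁ φ₂ w w').Valid := by
  obtain ⟨w₁, w₂, w₃⟩ := w
  obtain ⟨w₁', w₂', w₃'⟩ := w'
  simp only [pattern, Pattern.Valid, decide_eq_true_eq, Prod.mk.injEq]
  refine ⟨fun h => by rw [h], fun h => by rw [h], fun h => ⟨h.1, h.2.1⟩, ?_⟩
  rintro ⟨h1, h2, -, -, h3⟩
  exact h (by simp [h1, h2, h3])

theorem bookMass_nonneg (l : LetterBook Q U₁ U₂ X₁ X₂ X₃ M₁ M₂ M₃ K₁ K₂) :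
    0 ≤ G.bookMass φ₁ φ₂ l :=
  mul_nonneg (G.pQ_mem.1 _) (mul_nonneg (Finset.prod_nonneg fun _ _ => (G.a₁_mem _).1 _)
    (mul_nonneg (Finset.prod_nonneg fun _ _ => (G.a₂_mem _).1 _)
      (mul_nonneg (Finset.prod_nonneg fun _ _ => (G.b₁_mem _ _).1 _)
        (mul_nonneg (Finset.prod_nonneg fun _ _ => (G.b₂_mem _ _).1 _)
          (Finset.prod_nonneg fun _ _ => (G.p₃_mem _ _ _).1 _)))))

/-- The codebook is summed out from the innermost layer x₃ up to q. In each layer only the entries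
of the two triples matter, and `sum_prod_mul_pair` gives their joint law. -/
theorem sum_bookMass_mul (w w' : Fin M₁ × Fin M₂ × Fin M₃)
    (g : Q × U₁ × U₂ × X₁ × X₂ × X₃ → Q × U₁ × U₂ × X₁ × X₂ × X₃ → ℝ) :
    ∑ l, G.bookMass φ₁ φ₂ l * g (bookLetter φ₁ φ₂ l w) (bookLetter φ₁ φ₂ l w') =
      ∑ z', G.mass z' * ∑ z, G.cond (pattern φ₁ φ₂ w w') z z' * g z z' := by
  classical
  let s := pattern φ₁ φ₂ w w'
  -- The partial sums take pairs of letters, the first for `w` and the second for `w'`, so that the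
  -- iterated sum can finally be regrouped into one over two full inputs.
  let H₅ : Q × Q → U₁ × U₁ → U₂ × U₂ → X₁ × X₁ → X₂ × X₂ → ℝ := fun q u₁ u₂ x₁ x₂ =>
    ∑ t : X₃ × X₃, G.p₃ q.2 u₁.2 u₂.2 t.2 * condLetter s.x₃ (G.p₃ q.1 u₁.1 u₂.1) t.1 t.2 *
      g (q.1, u₁.1, u₂.1, x₁.1, x₂.1, t.1) (q.2, u₁.2, u₂.2, x₁.2, x₂.2, t.2)
  let H₄ : Q × Q → U₁ × U₁ → U₂ × U₂ → X₁ × X₁ → ℝ := fun q u₁ u₂ x₁ =>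
    ∑ t : X₂ × X₂, G.b₂ q.2 u₂.2 t.2 * condLetter s.x₂ (G.b₂ q.1 u₂.1) t.1 t.2 * H₅ q u₁ u₂ x₁ t
  let H₃ : Q × Q → U₁ × U₁ → U₂ × U₂ → ℝ := fun q u₁ u₂ =>
    ∑ t : X₁ × X₁, G.b₁ q.2 u₁.2 t.2 * condLetter s.x₁ (G.b₁ q.1 u₁.1) t.1 t.2 * H₄ q u₁ u₂ t
  let H₂ : Q × Q → U₁ × U₁ → ℝ := fun q u₁ =>
    ∑ t : U₂ × U₂, G.a₂ q.2 t.2 * condLetter s.u₂ (G.a₂ q.1) t.1 t.2 * H₃ q u₁ t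
  let H₁ : Q × Q → ℝ := fun q =>
    ∑ t : U₁ × U₁, G.a₁ q.2 t.2 * condLetter s.u₁ (G.a₁ q.1) t.1 t.2 * H₂ q t
  have e5 : ∀ q (c₁ : Fin K₁ → U₁) (c₂ : Fin K₂ → U₂) (d₁ : Fin M₁ → X₁) (d₂ : Fin M₂ → X₂),
      ∑ d₃ : Fin K₁ × Fin K₂ × Fin M₃ → X₃, (∏ i, G.p₃ q (c₁ i.1) (c₂ i.2.1) (d₃ i)) *
        g (bookLetter φ₁ φ₂ (q, c₁, c₂, d₁, d₂, d₃) w)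
          (bookLetter φ₁ φ₂ (q, c₁, c₂, d₁, d₂, d₃) w') =
      H₅ (q, q) (c₁ (φ₁ w.1), c₁ (φ₁ w'.1)) (c₂ (φ₂ w.2.1), c₂ (φ₂ w'.2.1)) (d₁ w.1, d₁ w'.1)
        (d₂ w.2.1, d₂ w'.2.1) := fun q c₁ c₂ d₁ d₂ =>
    sum_prod_mul_pair (p := fun i => G.p₃ q (c₁ i.1) (c₂ i.2.1)) (fun i => (G.p₃_mem _ _ _).2)
      (φ₁ w.1, φ₂ w.2.1, w.2.2) (φ₁ w'.1, φ₂ w'.2.1, w'.2.2)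
      (fun a b => g (q, c₁ (φ₁ w.1), c₂ (φ₂ w.2.1), d₁ w.1, d₂ w.2.1, a)
        (q, c₁ (φ₁ w'.1), c₂ (φ₂ w'.2.1), d₁ w'.1, d₂ w'.2.1, b))
  have e4 : ∀ q (c₁ : Fin K₁ → U₁) (c₂ : Fin K₂ → U₂) (d₁ : Fin M₁ → X₁),
      ∑ d₂ : Fin M₂ → X₂, (∏ i, G.b₂ q (c₂ (φ₂ i)) (d₂ i)) *
        H₅ (q, q) (c₁ (φ₁ w.1), c₁ (φ₁ w'.1)) (c₂ (φ₂ w.2.1), c₂ (φ₂ w'.2.1)) (d₁ w.1, d₁ w'.1)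
          (d₂ w.2.1, d₂ w'.2.1) =
      H₄ (q, q) (c₁ (φ₁ w.1), c₁ (φ₁ w'.1)) (c₂ (φ₂ w.2.1), c₂ (φ₂ w'.2.1))
        (d₁ w.1, d₁ w'.1) := fun q c₁ c₂ d₁ =>
    sum_prod_mul_pair (p := fun i => G.b₂ q (c₂ (φ₂ i))) (fun i => (G.b₂_mem _ _).2)
      w.2.1 w'.2.1 (fun a b => H₅ (q, q) (c₁ (φ₁ w.1), c₁ (φ₁ w'.1))
        (c₂ (φ₂ w.2.1), c₂ (φ₂ w'.2.1)) (d₁ w.1, d₁ w'.1) (a, b))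
  have e3 : ∀ q (c₁ : Fin K₁ → U₁) (c₂ : Fin K₂ → U₂),
      ∑ d₁ : Fin M₁ → X₁, (∏ i, G.b₁ q (c₁ (φ₁ i)) (d₁ i)) *
        H₄ (q, q) (c₁ (φ₁ w.1), c₁ (φ₁ w'.1)) (c₂ (φ₂ w.2.1), c₂ (φ₂ w'.2.1)) (d₁ w.1, d₁ w'.1) =
      H₃ (q, q) (c₁ (φ₁ w.1), c₁ (φ₁ w'.1)) (c₂ (φ₂ w.2.1), c₂ (φ₂ w'.2.1)) := fun q c₁ c₂ =>
    sum_prod_mul_pair (p := fun i => G.b₁ q (c₁ (φ₁ i))) (fun i => (G.b₁_mem _ _).2)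
      w.1 w'.1 (fun a b => H₄ (q, q) (c₁ (φ₁ w.1), c₁ (φ₁ w'.1))
        (c₂ (φ₂ w.2.1), c₂ (φ₂ w'.2.1)) (a, b))
  have e2 : ∀ q (c₁ : Fin K₁ → U₁), ∑ c₂ : Fin K₂ → U₂, (∏ i, G.a₂ q (c₂ i)) *
        H₃ (q, q) (c₁ (φ₁ w.1), c₁ (φ₁ w'.1)) (c₂ (φ₂ w.2.1), c₂ (φ₂ w'.2.1)) =
      H₂ (q, q) (c₁ (φ₁ w.1), c₁ (φ₁ w'.1)) := fun q c₁ =>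
    sum_prod_mul_pair (p := fun _ => G.a₂ q) (fun i => (G.a₂_mem _).2)
      (φ₂ w.2.1) (φ₂ w'.2.1) (fun a b => H₃ (q, q) (c₁ (φ₁ w.1), c₁ (φ₁ w'.1)) (a, b))
  have e1 : ∀ q, ∑ c₁ : Fin K₁ → U₁, (∏ i, G.a₁ q (c₁ i)) *
        H₂ (q, q) (c₁ (φ₁ w.1), c₁ (φ₁ w'.1)) = H₁ (q, q) := fun q =>
    sum_prod_mul_pair (p := fun _ => G.a₁ q) (fun i => (G.a₁_mem _).2)
      (φ₁ w.1) (φ₁ w'.1) (fun a b => H₂ (q, q) (a, b))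
  have e0 : ∑ q, G.pQ q * H₁ (q, q) =
      ∑ t : Q × Q, G.pQ t.2 * condLetter true G.pQ t.1 t.2 * H₁ t := by
    simp [Fintype.sum_prod_type, condLetter]
  have eL : ∑ l, G.bookMass φ₁ φ₂ l * g (bookLetter φ₁ φ₂ l w) (bookLetter φ₁ φ₂ l w') =
      ∑ q, G.pQ q * H₁ (q, q) := by
    simp only [Fintype.sum_prod_type (α₁ := Q), Fintype.sum_prod_type (α₁ := Fin K₁ → U₁),
      Fintype.sum_prod_type (α₁ := Fin K₂ → U₂), Fintype.sum_prod_type (α₁ := Fin M₁ → X₁),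
      Fintype.sum_prod_type (α₁ := Fin M₂ → X₂), bookMass, mul_assoc, ← Finset.mul_sum,
      e5, e4, e3, e2, e1]
  rw [eL, e0]
  let e : (Q × Q) × (U₁ × U₁) × (U₂ × U₂) × (X₁ × X₁) × (X₂ × X₂) × (X₃ × X₃) ≃
      (Q × U₁ × U₂ × X₁ × X₂ × X₃) × (Q × U₁ × U₂ × X₁ × X₂ × X₃) :=
    { toFun := fun t => ((t.1.2, t.2.1.2, t.2.2.1.2, t.2.2.2.1.2, t.2.2.2.2.1.2, t.2.2.2.2.2.2),
        (t.1.1, t.2.1.1, t.2.2.1.1, t.2.2.2.1.1, t.2.2.2.2.1.1, t.2.2.2.2.2.1))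
      invFun := fun z => ((z.2.1, z.1.1), (z.2.2.1, z.1.2.1), (z.2.2.2.1, z.1.2.2.1),
        (z.2.2.2.2.1, z.1.2.2.2.1), (z.2.2.2.2.2.1, z.1.2.2.2.2.1), (z.2.2.2.2.2.2, z.1.2.2.2.2.2))
      left_inv := fun _ => rfl
      right_inv := fun _ => rfl }
  have eR : ∑ z', G.mass z' * ∑ z, G.cond s z z' * g z z' =
      ∑ p : (Q × U₁ × U₂ × X₁ × X₂ × X₃) × (Q × U₁ × U₂ × X₁ × X₂ × X₃),
        G.mass p.1 * (G.cond s p.2 p.1 * g p.2 p.1) := by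
    simp only [Fintype.sum_prod_type (α₁ := Q × U₁ × U₂ × X₁ × X₂ × X₃), Finset.mul_sum]
  refine Eq.trans ?_ ((e.sum_comp _).trans eR.symm)
  rw [Fintype.sum_prod_type (α₁ := Q × Q)]
  refine Finset.sum_congr rfl fun q _ => ?_
  simp only [H₁, Finset.mul_sum]
  rw [Fintype.sum_prod_type (α₁ := U₁ × U₁)]
  refine Finset.sum_congr rfl fun u₁ _ => ?_
  simp only [H₂, Finset.mul_sum]
  rw [Fintype.sum_prod_type (α₁ := U₂ × U₂)]
  refine Finset.sum_congr rfl fun u₂ _ => ?_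
  simp only [H₃, Finset.mul_sum]
  rw [Fintype.sum_prod_type (α₁ := X₁ × X₁)]
  refine Finset.sum_congr rfl fun x₁ _ => ?_
  simp only [H₄, Finset.mul_sum]
  rw [Fintype.sum_prod_type (α₁ := X₂ × X₂)]
  refine Finset.sum_congr rfl fun x₂ _ => ?_
  simp only [H₅, Finset.mul_sum]
  refine Finset.sum_congr rfl fun x₃ _ => ?_
  simp only [mass, cond, e, Equiv.coe_fn_mk]
  ring

theorem sum_bookMass_mul_self (w : Fin M₁ × Fin M₂ × Fin M₃)
    (h : Q × U₁ × U₂ × X₁ × X₂ × X₃ → ℝ) :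
    ∑ l, G.bookMass φ₁ φ₂ l * h (bookLetter φ₁ φ₂ l w) = ∑ z, G.mass z * h z := by
  have := G.sum_bookMass_mul φ₁ φ₂ w w fun _ z' => h z'
  simpa only [← Finset.sum_mul, G.sum_cond, one_mul] using this

end FactoredLaw

/-! ### Existence of good codes -/

section Existence

variable {Q U₁ U₂ X₁ X₂ X₃ Y : Type*} [Fintype Q] [Fintype U₁] [Fintype U₂]
    [Fintype X₁] [Fintype X₂] [Fintype X₃] [Fintype Y]

open Classical in
-- The Chernoff bases `A` are chosen before the block length and the message sets, hence their
-- powers vanish as n grows. Thresholds are in nats, which explains the factor log 2.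
theorem FactoredLaw.exists_code (G : FactoredLaw Q U₁ U₂ X₁ X₂ X₃) {W : X₁ → X₂ → X₃ → Y → ℝ}
    (hW : ∀ x₁ x₂ x₃, W x₁ x₂ x₃ ∈ stdSimplex ℝ Y) (τ : Pattern → ℝ)
    (hτ : ∀ f : Pattern, f.Valid →
      τ f < Real.log 2 * classInfo G.mass (letterChannel Q U₁ U₂ W) f.Agree) :
    ∃ A : Pattern → ℝ, (∀ f, 0 ≤ A f ∧ A f < 1) ∧
      ∀ (n M₁ M₂ M₃ K₁ K₂ : ℕ) [NeZero M₁] [NeZero M₂] [NeZero M₃]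
        (φ₁ : Fin M₁ → Fin K₁) (φ₂ : Fin M₂ → Fin K₂),
        ∃ c : Code X₁ X₂ X₃ Y n M₁ M₂ M₃ K₁ K₂, c.errorProb W ≤
          (∑ w : Fin M₁ × Fin M₂ × Fin M₃, (∑ f : Pattern, A f ^ n + ∑ w' with w' ≠ w,
            Real.exp (-(n * τ (FactoredLaw.pattern φ₁ φ₂ w w'))))) /
              Fintype.card (Fin M₁ × Fin M₂ × Fin M₃) := by
  set V := letterChannel Q U₁ U₂ W with hVdef
  have hV0 : ∀ z y, 0 ≤ V z y := fun z y => (hW _ _ _).1 y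
  have hV1 : ∀ z, ∑ y, V z y = 1 := fun z => (hW _ _ _).2
  have hlog2 : Real.log 2 ≠ 0 := (Real.log_pos one_lt_two).ne'
  let L : Pattern → Q × U₁ × U₂ × X₁ × X₂ × X₃ → Y → ℝ := fun f z y =>
    Real.log (V z y / classKernel G.mass V f.Agree z y)
  have hex : ∀ f : Pattern, f.Valid → ∃ θ, 0 ≤ θ ∧
      ∑ z, G.mass z * ∑ y, V z y * Real.exp (θ * (τ f - L f z y)) < 1 := by
    intro f hf
    have hsum : ∑ ω : (Q × U₁ × U₂ × X₁ × X₂ × X₃) × Y, G.mass ω.1 * V ω.1 ω.2 = 1 := by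
      simp only [Fintype.sum_prod_type (α₁ := Q × U₁ × U₂ × X₁ × X₂ × X₃), ← Finset.mul_sum, hV1,
        mul_one, G.sum_mass]
    obtain ⟨θ, h0, h1⟩ := exists_sum_mul_exp_lt_one (x := fun ω => τ f - L f ω.1 ω.2) hsum (by
      simp only [mul_sub, Finset.sum_sub_distrib, ← Finset.sum_mul, hsum, one_mul]
      rw [sub_neg]
      refine (hτ f hf).trans_eq ?_
      rw [classInfo, Finset.mul_sum,
        Fintype.sum_prod_type (α₁ := Q × U₁ × U₂ × X₁ × X₂ × X₃)]
      refine Finset.sum_congr rfl fun z _ => ?_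
      rw [Finset.mul_sum]
      refine Finset.sum_congr rfl fun y _ => ?_
      dsimp only [L, Real.logb]
      field_simp)
    refine ⟨θ, h0, lt_of_eq_of_lt ?_ h1⟩
    simp only [Fintype.sum_prod_type (α₁ := Q × U₁ × U₂ × X₁ × X₂ × X₃), Finset.mul_sum, mul_assoc]
  choose! θ hθ0 hθ1 using hex
  let A : Pattern → ℝ := fun f => if f.Valid then
    ∑ z, G.mass z * ∑ y, V z y * Real.exp (θ f * (τ f - L f z y)) else 0
  have hA0 : ∀ f, 0 ≤ A f := fun f => by
    dsimp only [A]
    split_ifs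
    exacts [Finset.sum_nonneg fun z _ => mul_nonneg (G.mass_nonneg z) (Finset.sum_nonneg fun y _ =>
      mul_nonneg (hV0 _ _) (Real.exp_pos _).le), le_rfl]
  refine ⟨A, fun f => ⟨hA0 f, ?_⟩, ?_⟩
  · dsimp only [A]
    split_ifs with hf
    exacts [hθ1 f hf, zero_lt_one]
  intro n M₁ M₂ M₃ K₁ K₂ _ _ _ φ₁ φ₂
  -- Change of measure: given the competitor's letter z', the output caused by the true triple has
  -- law `classKernel` at z'. This cancels the denominator of the likelihood ratio and leaves a sum
  -- of V z' over at most all outputs.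
  have hpair : ∀ w w' : Fin M₁ × Fin M₂ × Fin M₃, w' ≠ w → ∑ l, G.bookMass φ₁ φ₂ l *
      ∑ y, V (bookLetter φ₁ φ₂ l w) y * (if V (bookLetter φ₁ φ₂ l w') y = 0 then 0 else
        Real.exp (L (pattern φ₁ φ₂ w w') (bookLetter φ₁ φ₂ l w') y)) ≤ 1 := by
    intro w w' hne
    have hf := pattern_valid φ₁ φ₂ hne
    set f := pattern φ₁ φ₂ w w' with hfdef
    rw [G.sum_bookMass_mul φ₁ φ₂ w w' fun z z' => ∑ y, V z y *
      (if V z' y = 0 then 0 else Real.exp (L f z' y)), ← hfdef, ← G.sum_mass]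
    refine Finset.sum_le_sum fun z' _ => ?_
    by_cases hz : G.mass z' = 0
    · simp [hz]
    refine mul_le_of_le_one_right (G.mass_nonneg z') ?_
    rw [← hV1 z']
    have e1 : ∑ z, G.cond f z z' * ∑ y, V z y * (if V z' y = 0 then 0 else
        Real.exp (L f z' y)) = ∑ y, classKernel G.mass V f.Agree z' y *
          (if V z' y = 0 then 0 else Real.exp (L f z' y)) := by
      simp only [G.classKernel_mass hf V hz, Finset.mul_sum, Finset.sum_mul]
      rw [Finset.sum_comm]
      simp only [mul_assoc]
    rw [e1]
    refine Finset.sum_le_sum fun y _ => ?_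
    split_ifs with hy
    · simp [hy]
    · have hpos := classKernel_pos G.mass_nonneg hV0 (Pattern.Agree.refl f) hz hy
      rw [Real.exp_log (div_pos (lt_of_le_of_ne (hV0 _ _) (Ne.symm hy)) hpos),
        mul_div_cancel₀ _ hpos.ne']
  have hbook1 : ∑ l, G.bookMass (M₃ := M₃) φ₁ φ₂ l = 1 := by
    have := G.sum_bookMass_mul_self (M₃ := M₃) φ₁ φ₂ (0, 0, 0) fun _ => 1
    simpa [G.sum_mass] using this
  obtain ⟨cb, dec, hcb⟩ := exists_codebook n (G.bookMass_nonneg φ₁ φ₂) hbook1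
    (bookLetter φ₁ φ₂) hV0 (Finset.univ.filter Pattern.Valid) L τ θ A
    (fun f hf => hθ0 f (Finset.mem_filter.1 hf).2)
    (fun f hf w => by
      rw [G.sum_bookMass_mul_self φ₁ φ₂ w fun z =>
        ∑ y, V z y * Real.exp (θ f * (τ f - L f z y))]
      exact (if_pos (Finset.mem_filter.1 hf).2).ge)
    (pattern φ₁ φ₂) (fun w w' h => Finset.mem_filter.2 ⟨Finset.mem_univ _, pattern_valid φ₁ φ₂ h⟩)
    hpair
  let c : Code X₁ X₂ X₃ Y n M₁ M₂ M₃ K₁ K₂ :=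
    { link₁ := φ₁
      link₂ := φ₂
      enc₁ := fun w j => (cb j).2.2.2.1 w
      enc₂ := fun w j => (cb j).2.2.2.2.1 w
      enc₃ := fun v₁ v₂ w j => (cb j).2.2.2.2.2 (v₁, v₂, w)
      dec := dec }
  refine ⟨c, ?_⟩
  have herr : c.errorProb W = (∑ w, ∑ y with dec y ≠ w,
      ∏ j, V (bookLetter φ₁ φ₂ (cb j) w) (y j)) / Fintype.card (Fin M₁ × Fin M₂ × Fin M₃) := by
    simp only [Fintype.sum_prod_type (α₁ := Fin M₁), Fintype.sum_prod_type (α₁ := Fin M₂),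
      Fintype.card_prod, Fintype.card_fin, Nat.cast_mul, ← mul_assoc, Code.errorProb]
    rfl
  rw [herr]
  refine div_le_div_of_nonneg_right ?_ (by positivity)
  refine le_trans (le_of_eq ?_) (hcb.trans (Finset.sum_le_sum fun w _ => add_le_add
    (Finset.sum_le_sum_of_subset_of_nonneg (Finset.filter_subset _ _)
      fun f _ _ => pow_nonneg (hA0 f) n) (le_of_eq ?_))) <;> congr!

end Existence

/-! ### The number of messages with a given pattern -/

/-- Messages are distributed over the letters of the link by their residues. -/
def linkMap (M : ℕ) {K : ℕ} (hK : K ≠ 0) (w : Fin M) : Fin K :=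
  ⟨w % K, Nat.mod_lt _ (Nat.pos_of_ne_zero hK)⟩

/-- Messages with the same residue are told apart by their quotients, which range over 0, …, M / K.
-/
theorem card_linkMap_eq_le (M : ℕ) {K : ℕ} (hK : K ≠ 0) (v : Fin K) :
    (Finset.univ.filter fun w : Fin M => v = linkMap M hK w).card ≤ M / K + 1 := by
  rw [← Finset.card_range (M / K + 1)]
  refine Finset.card_le_card_of_injOn (fun w => (w : ℕ) / K) (fun w _ => ?_) fun w hw w' hw' h => ?_
  · simp only [Finset.coe_range, Set.mem_Iio]
    exact Nat.lt_succ_of_le (Nat.div_le_div_right w.2.le)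
  · simp only [Finset.coe_filter, Finset.mem_univ, true_and, Set.mem_ofPred_eq] at hw hw'
    have h1 : (w : ℕ) % K = w' % K := congrArg Fin.val (hw.symm.trans hw')
    have h2 : (w : ℕ) / K = w' / K := h
    apply Fin.ext
    rw [← Nat.div_add_mod (w : ℕ) K, ← Nat.div_add_mod (w' : ℕ) K, h1, h2]

theorem numMessages_le {R : ℝ} (hR : 0 ≤ R) (n : ℕ) :
    (numMessages R n : ℝ) ≤ 2 * 2 ^ ((n : ℝ) * R) := by
  have h1 : (numMessages R n : ℝ) < 2 ^ ((n : ℝ) * R) + 1 := Nat.ceil_lt_add_one (by positivity)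
  have h2 : (1 : ℝ) ≤ 2 ^ ((n : ℝ) * R) := Real.one_le_rpow one_le_two (by positivity)
  linarith

theorem le_linkSize {C : ℝ} (hC : 0 ≤ C) (n : ℕ) :
    (2 : ℝ) ^ ((n : ℝ) * C) ≤ 2 * linkSize C n := by
  have h1 : (2 : ℝ) ^ ((n : ℝ) * C) < linkSize C n + 1 := Nat.lt_floor_add_one _
  have h2 : (1 : ℝ) ≤ linkSize C n := by
    exact_mod_cast Nat.one_le_iff_ne_zero.2 (linkSize_ne_zero hC n)
  linarith

theorem numMessages_zero (n : ℕ) : numMessages 0 n = 1 := by simp [numMessages]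

theorem eventually_numMessages_le_linkSize {R C : ℝ} (hR : 0 ≤ R) (hRC : R < C) :
    ∀ᶠ n : ℕ in Filter.atTop, numMessages R n ≤ linkSize C n := by
  have ht : Filter.Tendsto (fun n : ℕ => (n : ℝ) * (C - R)) Filter.atTop Filter.atTop :=
    tendsto_natCast_atTop_atTop.atTop_mul_const (sub_pos.2 hRC)
  filter_upwards [ht.eventually_ge_atTop 1] with n hn
  have h1 := numMessages_le hR n
  refine Nat.le_floor (h1.trans ?_)
  have h2 : (2 : ℝ) ^ ((n : ℝ) * C) = 2 ^ ((n : ℝ) * R) * 2 ^ ((n : ℝ) * (C - R)) := by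
    rw [← Real.rpow_add two_pos]; ring_nf
  have h3 : (2 : ℝ) ≤ 2 ^ ((n : ℝ) * (C - R)) := by
    simpa using Real.rpow_le_rpow_of_exponent_le one_le_two hn
  rw [h2, mul_comm]
  exact mul_le_mul_of_nonneg_left h3 (by positivity)

/-- A source of rate `R` with link capacity `C` has other messages with the given pattern. -/
def sourceActive (u x : Bool) (R C : ℝ) : Prop := ¬x → if u then C < R else 0 < R

/-- If R < C the residue map is eventually injective, so no second message has the same link letter;
if R > C the residue classes have the expected size. `hRC` excludes the critical case, where
rounding could leave collisions although the exponent is 0. The constant is 5 = 4 + 1: a factor 2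
from each of two roundings, and the extra element of a residue class. -/
theorem eventually_card_source_le {R C : ℝ} (hR : 0 ≤ R) (hC : 0 ≤ C) (hRC : R = C → R = 0) :
    ∀ᶠ n : ℕ in Filter.atTop, ∀ (u x : Bool) (w : Fin (numMessages R n)),
      let φ := linkMap (numMessages R n) (linkSize_ne_zero hC n)
      let S := Finset.univ.filter fun w' => decide (φ w = φ w') = u ∧ decide (w = w') = x
      (S.card : ℝ) ≤ 5 * 2 ^ ((n : ℝ) * sourceRate u x R C) ∧
        (S.Nonempty → sourceActive u x R C) := by
  have hev : ∀ᶠ n : ℕ in Filter.atTop, R < C → numMessages R n ≤ linkSize C n := by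
    by_cases h : R < C
    · filter_upwards [eventually_numMessages_le_linkSize hR h] with n hn _ using hn
    · exact Filter.Eventually.of_forall fun _ k => absurd k h
  filter_upwards [hev] with n hn u x w
  intro φ S
  have hact : S.Nonempty → sourceActive u x R C := by
    rintro ⟨w', hw'⟩ hx
    simp only [S, Finset.mem_filter, Finset.mem_univ, true_and] at hw'
    obtain ⟨hu, hx'⟩ := hw'
    have hne : w ≠ w' := by
      simpa [Bool.not_eq_true] using hx'.trans (Bool.eq_false_iff.2 hx)
    have hR0 : R ≠ 0 := by
      rintro rfl
      have := numMessages_zero n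
      exact hne (Fin.ext (by omega))
    have hRpos : 0 < R := lt_of_le_of_ne hR (Ne.symm hR0)
    cases u
    · simpa using hRpos
    · simp only [if_true]
      by_contra hle
      rcases lt_or_eq_of_le (not_lt.1 hle) with hlt | heq
      · have hMK := hn hlt
        have h1 : φ w = φ w' := of_decide_eq_true hu
        have h2 : (w : ℕ) % linkSize C n = w' % linkSize C n := congrArg Fin.val h1
        rw [Nat.mod_eq_of_lt (w.2.trans_le hMK), Nat.mod_eq_of_lt (w'.2.trans_le hMK)] at h2
        exact hne (Fin.ext h2)
      · exact hR0 (hRC heq)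
  refine ⟨?_, hact⟩
  rcases S.eq_empty_or_nonempty with hS | hS
  · rw [hS]; simp; positivity
  have hact' := hact hS
  cases x
  · have hact' := hact' (by simp)
    cases u
    · simp only [sourceRate, Bool.false_eq_true, if_false]
      have h1 : (S.card : ℝ) ≤ numMessages R n := by
        exact_mod_cast (Finset.card_le_univ S).trans_eq (Fintype.card_fin _)
      have h2 := numMessages_le hR n
      have h3 : (0 : ℝ) < 2 ^ ((n : ℝ) * R) := by positivity
      linarith
    · simp only [sourceRate, Bool.false_eq_true, if_false, if_true] at hact' ⊢
      have hKpos : (0 : ℝ) < linkSize C n := by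
        exact_mod_cast Nat.pos_of_ne_zero (linkSize_ne_zero hC n)
      have h1 : S.card ≤ numMessages R n / linkSize C n + 1 := by
        refine le_trans (Finset.card_le_card fun w' hw' => ?_)
          (card_linkMap_eq_le (numMessages R n) (linkSize_ne_zero hC n) (φ w))
        simp only [S, Finset.mem_filter, Finset.mem_univ, true_and, decide_eq_true_eq] at hw' ⊢
        exact hw'.1
      have h2 : (S.card : ℝ) ≤ numMessages R n / linkSize C n + 1 := by
        have h3 : (S.card : ℝ) ≤ ((numMessages R n / linkSize C n : ℕ) : ℝ) + 1 := by
          exact_mod_cast h1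
        linarith [@Nat.cast_div_le ℝ _ _ _ (numMessages R n) (linkSize C n)]
      have h3 : (numMessages R n : ℝ) / linkSize C n ≤ 4 * 2 ^ ((n : ℝ) * (R - C)) := by
        rw [div_le_iff₀ hKpos]
        have h4 : (2 : ℝ) ^ ((n : ℝ) * R) = 2 ^ ((n : ℝ) * (R - C)) * 2 ^ ((n : ℝ) * C) := by
          rw [← Real.rpow_add two_pos]; ring_nf
        have h5 := mul_le_mul_of_nonneg_left (le_linkSize hC n)
          (show (0 : ℝ) ≤ 2 ^ ((n : ℝ) * (R - C)) by positivity)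
        have h6 := numMessages_le hR n
        rw [h4] at h6
        linarith
      have h4 : (1 : ℝ) ≤ 2 ^ ((n : ℝ) * (R - C)) :=
        Real.one_le_rpow one_le_two (mul_nonneg (by positivity) (sub_pos.2 hact').le)
      linarith
  · have h1 : S.card ≤ 1 := by
      refine Finset.card_le_one.2 fun a ha b hb => ?_
      simp only [S, Finset.mem_filter, Finset.mem_univ, true_and, decide_eq_true_eq] at ha hb
      exact ha.2.symm.trans hb.2
    have h2 : (S.card : ℝ) ≤ 1 := by exact_mod_cast h1
    simp only [sourceRate, if_true, mul_zero, Real.rpow_zero]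
    linarith

/-- Some pair of message triples has the given pattern. -/
def Pattern.Active (f : Pattern) (C₁ C₂ R₁ R₂ R₃ : ℝ) : Prop :=
  sourceActive f.u₁ f.x₁ R₁ C₁ ∧ sourceActive f.u₂ f.x₂ R₂ C₂ ∧ (¬f.x₃ → f.u₁ → f.u₂ → 0 < R₃)

/-- The triples with a given pattern lie in a product of three sets, one per message, and 50 = 5 · 5
· 2. -/
theorem eventually_card_pattern_le {C₁ C₂ R₁ R₂ R₃ : ℝ} (hR₁ : 0 ≤ R₁) (hR₂ : 0 ≤ R₂)
    (hR₃ : 0 ≤ R₃) (hC₁ : 0 ≤ C₁) (hC₂ : 0 ≤ C₂) (h₁ : R₁ = C₁ → R₁ = 0)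
    (h₂ : R₂ = C₂ → R₂ = 0) :
    ∀ᶠ n : ℕ in Filter.atTop, ∀ (f : Pattern)
      (w : Fin (numMessages R₁ n) × Fin (numMessages R₂ n) × Fin (numMessages R₃ n)),
      let φ₁ := linkMap (numMessages R₁ n) (linkSize_ne_zero hC₁ n)
      let φ₂ := linkMap (numMessages R₂ n) (linkSize_ne_zero hC₂ n)
      let S := Finset.univ.filter fun w' => FactoredLaw.pattern φ₁ φ₂ w w' = f
      (S.card : ℝ) ≤ 50 * 2 ^ ((n : ℝ) * f.rate C₁ C₂ R₁ R₂ R₃) ∧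
        (S.Nonempty → f.Active C₁ C₂ R₁ R₂ R₃) := by
  filter_upwards [eventually_card_source_le hR₁ hC₁ h₁, eventually_card_source_le hR₂ hC₂ h₂]
    with n k₁ k₂ f w
  intro φ₁ φ₂ S
  obtain ⟨c₁, a₁⟩ := k₁ f.u₁ f.x₁ w.1
  obtain ⟨c₂, a₂⟩ := k₂ f.u₂ f.x₂ w.2.1
  set S₁ := Finset.univ.filter fun w' => decide (φ₁ w.1 = φ₁ w') = f.u₁ ∧ decide (w.1 = w') = f.x₁
  set S₂ := Finset.univ.filter fun w' =>
    decide (φ₂ w.2.1 = φ₂ w') = f.u₂ ∧ decide (w.2.1 = w') = f.x₂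
  let S₃ := Finset.univ.filter fun w₃ : Fin (numMessages R₃ n) => f.x₃ → w.2.2 = w₃
  have hmem : ∀ w' ∈ S, w'.1 ∈ S₁ ∧ w'.2.1 ∈ S₂ ∧ w'.2.2 ∈ S₃ ∧
      (¬f.x₃ → f.u₁ → f.u₂ → w.2.2 ≠ w'.2.2) := by
    intro w' hw'
    have hp := (Finset.mem_filter.1 hw').2
    have g1 := congrArg Pattern.u₁ hp
    have g2 := congrArg Pattern.x₁ hp
    have g3 := congrArg Pattern.u₂ hp
    have g4 := congrArg Pattern.x₂ hp
    have g5 := congrArg Pattern.x₃ hp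
    simp only [FactoredLaw.pattern] at g1 g2 g3 g4 g5
    refine ⟨Finset.mem_filter.2 ⟨Finset.mem_univ _, g1, g2⟩,
      Finset.mem_filter.2 ⟨Finset.mem_univ _, g3, g4⟩,
      Finset.mem_filter.2 ⟨Finset.mem_univ _, fun h => ?_⟩, fun h3 h1 h2 he => h3 ?_⟩
    · rw [h] at g5
      have := of_decide_eq_true g5
      simp only [Prod.mk.injEq] at this
      exact this.2.2
    · rw [h1] at g1
      rw [h2] at g3
      rw [← g5, of_decide_eq_true g1, of_decide_eq_true g3, he]
      simp
  constructor
  · have hsub : S ⊆ S₁ ×ˢ S₂ ×ˢ S₃ := fun w' hw' => by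
      obtain ⟨m1, m2, m3, -⟩ := hmem w' hw'
      exact Finset.mem_product.2 ⟨m1, Finset.mem_product.2 ⟨m2, m3⟩⟩
    have hcard : (S.card : ℝ) ≤ S₁.card * (S₂.card * S₃.card) := by
      have := Finset.card_le_card hsub
      rw [Finset.card_product, Finset.card_product] at this
      exact_mod_cast this
    have c₃ : (S₃.card : ℝ) ≤ 2 * 2 ^ ((n : ℝ) * if f.x₃ then 0 else R₃) := by
      split_ifs with h
      · have : S₃.card ≤ 1 := by
          refine Finset.card_le_one.2 fun a ha b hb => ?_
          exact ((Finset.mem_filter.1 ha).2 h).symm.trans ((Finset.mem_filter.1 hb).2 h)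
        have h2 : (S₃.card : ℝ) ≤ 1 := by exact_mod_cast this
        simp only [mul_zero, Real.rpow_zero]
        linarith
      · refine le_trans ?_ (numMessages_le hR₃ n)
        exact_mod_cast (Finset.card_le_univ S₃).trans_eq (Fintype.card_fin _)
    calc (S.card : ℝ) ≤ S₁.card * (S₂.card * S₃.card) := hcard
      _ ≤ (5 * 2 ^ ((n : ℝ) * sourceRate f.u₁ f.x₁ R₁ C₁)) *
          ((5 * 2 ^ ((n : ℝ) * sourceRate f.u₂ f.x₂ R₂ C₂)) *
            (2 * 2 ^ ((n : ℝ) * if f.x₃ then 0 else R₃))) := by gcongr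
      _ = 50 * 2 ^ ((n : ℝ) * f.rate C₁ C₂ R₁ R₂ R₃) := by
          rw [Pattern.rate, mul_add, mul_add, Real.rpow_add two_pos, Real.rpow_add two_pos]
          ring
  · rintro ⟨w', hw'⟩
    obtain ⟨m1, m2, -, m3⟩ := hmem w' hw'
    refine ⟨a₁ ⟨_, m1⟩, a₂ ⟨_, m2⟩, fun h3 h1 h2 => ?_⟩
    refine lt_of_le_of_ne hR₃ ?_
    rintro rfl
    have := numMessages_zero n
    exact m3 h3 h1 h2 (Fin.ext (by omega))

theorem tendsto_exp_nat_mul {a : ℝ} (ha : a < 0) :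
    Filter.Tendsto (fun n : ℕ => Real.exp (n * a)) Filter.atTop (𝓝 0) :=
  Real.tendsto_exp_atBot.comp (tendsto_natCast_atTop_atTop.atTop_mul_const_of_neg ha)

theorem Code.errorProb_nonneg {X₁ X₂ X₃ Y : Type*} [Fintype Y] {n M₁ M₂ M₃ K₁ K₂ : ℕ}
    {W : X₁ → X₂ → X₃ → Y → ℝ} (hW : ∀ x₁ x₂ x₃, W x₁ x₂ x₃ ∈ stdSimplex ℝ Y)
    (c : Code X₁ X₂ X₃ Y n M₁ M₂ M₃ K₁ K₂) : 0 ≤ c.errorProb W :=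
  div_nonneg (Finset.sum_nonneg fun _ _ => Finset.sum_nonneg fun _ _ => Finset.sum_nonneg fun _ _ =>
    Finset.sum_nonneg fun _ _ => Finset.prod_nonneg fun _ _ => (hW _ _ _).1 _) (by positivity)

theorem nonempty_of_mem_stdSimplex {A : Type*} [Fintype A] {p : A → ℝ} (hp : p ∈ stdSimplex ℝ A) :
    Nonempty A := by
  by_contra h
  have := not_nonempty_iff.1 h
  simpa using hp.2

/-! ### Achievability of the single-letter region -/

section Achievability

variable {Q U₁ U₂ X₁ X₂ X₃ Y : Type*} [Fintype Q] [Fintype U₁] [Fintype U₂]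
    [Fintype X₁] [Fintype X₂] [Fintype X₃] [Fintype Y]

theorem InputLaw.nonempty (P : InputLaw Q U₁ U₂ X₁ X₂ X₃) : Nonempty X₁ ∧ Nonempty X₂ := by
  obtain ⟨q⟩ := nonempty_of_mem_stdSimplex P.pQ_mem
  exact ⟨(nonempty_of_mem_stdSimplex (P.p₁_mem q)).map Prod.fst,
    (nonempty_of_mem_stdSimplex (P.p₂_mem q)).map Prod.fst⟩

open Classical in
-- Strict inequality is demanded only for active patterns, since the others eventually have no
-- competitors. This matters when a rate is 0 and the corresponding information is 0 too.
theorem InputLaw.achievable (P : InputLaw Q U₁ U₂ X₁ X₂ X₃) {W : X₁ → X₂ → X₃ → Y → ℝ}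
    (hW : ∀ x₁ x₂ x₃, W x₁ x₂ x₃ ∈ stdSimplex ℝ Y) {C₁ C₂ R₁ R₂ R₃ : ℝ} (hR₁ : 0 ≤ R₁)
    (hR₂ : 0 ≤ R₂) (hR₃ : 0 ≤ R₃) (hC₁ : 0 ≤ C₁) (hC₂ : 0 ≤ C₂) (h₁ : R₁ = C₁ → R₁ = 0)
    (h₂ : R₂ = C₂ → R₂ = 0)
    (hlt : ∀ f : Pattern, f.Valid → f.Active C₁ C₂ R₁ R₂ R₃ →
      f.rate C₁ C₂ R₁ R₂ R₃ < classInfo P.input (letterChannel Q U₁ U₂ W) f.Agree) :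
    Achievable W C₁ C₂ (R₁, R₂, R₃) := by
  have hlog2 : 0 < Real.log 2 := Real.log_pos one_lt_two
  obtain ⟨hX₁, hX₂⟩ := P.nonempty
  obtain ⟨G, hG⟩ := P.exists_factoredLaw
  let I : Pattern → ℝ := fun f => classInfo P.input (letterChannel Q U₁ U₂ W) f.Agree
  let ρ : Pattern → ℝ := fun f => f.rate C₁ C₂ R₁ R₂ R₃
  -- Midway between rate and information, the threshold beats the number of competitors and is still
  -- met by the true triple. For inactive patterns any value below the information will do.
  let τ : Pattern → ℝ := fun f => Real.log 2 *
    if f.Active C₁ C₂ R₁ R₂ R₃ then (ρ f + I f) / 2 else I f - 1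
  obtain ⟨A, hA, hcode⟩ := G.exists_code hW τ (fun f hf => by
    rw [hG]
    refine mul_lt_mul_of_pos_left ?_ hlog2
    split_ifs with h
    · have : ρ f < I f := hlt f hf h
      change (ρ f + I f) / 2 < I f
      linarith
    · exact sub_one_lt (I f))
  choose c hc using fun n : ℕ => hcode n (numMessages R₁ n) (numMessages R₂ n) (numMessages R₃ n)
    (linkSize C₁ n) (linkSize C₂ n) (linkMap _ (linkSize_ne_zero hC₁ n))
    (linkMap _ (linkSize_ne_zero hC₂ n))
  refine ⟨⟨hR₁, hR₂, hR₃⟩, c, ?_⟩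
  let e : Pattern → ℕ → ℝ := fun f n => if f.Valid ∧ f.Active C₁ C₂ R₁ R₂ R₃ then
    50 * Real.exp (n * (Real.log 2 * ρ f - τ f)) else 0
  have he0 : ∀ f n, 0 ≤ e f n := fun f n => by
    dsimp only [e]; split_ifs <;> positivity
  have hlim : Filter.Tendsto (fun n : ℕ => ∑ f : Pattern, A f ^ n + ∑ f : Pattern, e f n)
      Filter.atTop (𝓝 0) := by
    have t1 : Filter.Tendsto (fun n : ℕ => ∑ f : Pattern, A f ^ n) Filter.atTop
        (𝓝 (∑ _f : Pattern, 0)) :=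
      tendsto_finsetSum _ fun f _ => tendsto_pow_atTop_nhds_zero_of_lt_one (hA f).1 (hA f).2
    have t2 : Filter.Tendsto (fun n : ℕ => ∑ f : Pattern, e f n) Filter.atTop
        (𝓝 (∑ _f : Pattern, 0)) := by
      refine tendsto_finsetSum _ fun f _ => ?_
      by_cases h : f.Valid ∧ f.Active C₁ C₂ R₁ R₂ R₃
      · have hρ : ρ f < I f := hlt f h.1 h.2
        have hneg : Real.log 2 * ρ f - τ f < 0 := by
          simp only [τ, if_pos h.2]
          nlinarith
        simpa only [e, if_pos h, mul_zero] using (tendsto_exp_nat_mul hneg).const_mul 50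
      · simp only [e, if_neg h]
        exact tendsto_const_nhds
    simpa using t1.add t2
  refine tendsto_of_tendsto_of_tendsto_of_le_of_le' tendsto_const_nhds hlim
    (Filter.Eventually.of_forall fun n => (c n).errorProb_nonneg hW) ?_
  filter_upwards [eventually_card_pattern_le hR₁ hR₂ hR₃ hC₁ hC₂ h₁ h₂] with n hn
  refine (hc n).trans ?_
  have hcard : (0 : ℝ) < Fintype.card (Fin (numMessages R₁ n) × Fin (numMessages R₂ n) ×
      Fin (numMessages R₃ n)) := by exact_mod_cast Fintype.card_pos
  rw [div_le_iff₀ hcard]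
  refine (Finset.sum_le_card_nsmul _ _ _ fun w _ => add_le_add
    (le_refl (∑ f : Pattern, A f ^ n)) ?_).trans_eq (by rw [nsmul_eq_mul, mul_comm]; rfl)
  rw [← Finset.sum_fiberwise (g := FactoredLaw.pattern (linkMap _ (linkSize_ne_zero hC₁ n))
    (linkMap _ (linkSize_ne_zero hC₂ n)) w)]
  refine Finset.sum_le_sum fun f _ => ?_
  obtain ⟨hn1, hn2⟩ := hn f w
  set S := Finset.univ.filter fun w' => FactoredLaw.pattern (linkMap _ (linkSize_ne_zero hC₁ n))
    (linkMap _ (linkSize_ne_zero hC₂ n)) w w' = f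
  rw [Finset.filter_filter]
  rcases Finset.eq_empty_or_nonempty (Finset.univ.filter fun w' => w' ≠ w ∧
    FactoredLaw.pattern (linkMap _ (linkSize_ne_zero hC₁ n))
    (linkMap _ (linkSize_ne_zero hC₂ n)) w w' = f) with hE | ⟨w', hw'⟩
  · rw [hE, Finset.sum_empty]
    exact he0 f n
  have hw'' := (Finset.mem_filter.1 hw').2
  have hvalid : f.Valid := hw''.2 ▸ FactoredLaw.pattern_valid _ _ hw''.1
  have hactive := hn2 ⟨w', Finset.mem_filter.2 ⟨Finset.mem_univ _, hw''.2⟩⟩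
  calc _ = ∑ w' with w' ≠ w ∧ FactoredLaw.pattern (linkMap _ (linkSize_ne_zero hC₁ n))
        (linkMap _ (linkSize_ne_zero hC₂ n)) w w' = f, Real.exp (-(n * τ f)) :=
        Finset.sum_congr rfl fun w' hw' => by rw [(Finset.mem_filter.1 hw').2.2]
    _ ≤ ∑ w' ∈ S, Real.exp (-(n * τ f)) :=
        Finset.sum_le_sum_of_subset_of_nonneg (fun w' hw' => Finset.mem_filter.2
          ⟨Finset.mem_univ _, (Finset.mem_filter.1 hw').2.2⟩) fun _ _ _ => (Real.exp_pos _).le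
    _ = S.card * Real.exp (-(n * τ f)) := by rw [Finset.sum_const, nsmul_eq_mul]
    _ ≤ 50 * 2 ^ ((n : ℝ) * ρ f) * Real.exp (-(n * τ f)) :=
        mul_le_mul_of_nonneg_right hn1 (Real.exp_pos _).le
    _ = e f n := by
        simp only [e, if_pos (And.intro hvalid hactive)]
        rw [Real.rpow_def_of_pos two_pos, mul_assoc, ← Real.exp_add]
        ring_nf

/-- An active source whose message is not shared has positive rate, so scaling lowers its exponent
strictly. -/
theorem sourceRate_mul_lt {u x : Bool} {R C l : ℝ} (hC : 0 ≤ C) (hR : 0 ≤ R)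
    (hl : l < 1) (h : sourceActive u x (l * R) C) :
    sourceRate u x (l * R) C ≤ sourceRate u x R C ∧
      (¬x → sourceRate u x (l * R) C < sourceRate u x R C) := by
  unfold sourceActive at h
  unfold sourceRate
  by_cases hx : x
  · simp [hx]
  have h := h hx
  simp only [hx, if_false, not_false_eq_true, forall_const, Bool.false_eq_true]
  have hpos : 0 < R := by
    split_ifs at h <;> nlinarith
  split_ifs <;> constructor <;> nlinarith

theorem Pattern.rate_mul_lt {f : Pattern} (hf : f.Valid) {C₁ C₂ R₁ R₂ R₃ l : ℝ} (hC₁ : 0 ≤ C₁)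
    (hC₂ : 0 ≤ C₂) (hR₁ : 0 ≤ R₁) (hR₂ : 0 ≤ R₂) (hR₃ : 0 ≤ R₃) (hl0 : 0 < l) (hl : l < 1)
    (h : f.Active C₁ C₂ (l * R₁) (l * R₂) (l * R₃)) :
    f.rate C₁ C₂ (l * R₁) (l * R₂) (l * R₃) < f.rate C₁ C₂ R₁ R₂ R₃ := by
  obtain ⟨k1, k2, k3⟩ := h
  obtain ⟨a1, b1⟩ := sourceRate_mul_lt hC₁ hR₁ hl k1
  obtain ⟨a2, b2⟩ := sourceRate_mul_lt hC₂ hR₂ hl k2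
  obtain ⟨v1, v2, v3, v4⟩ := hf
  have a3 : (if f.x₃ then 0 else l * R₃) ≤ if f.x₃ then 0 else R₃ := by
    split_ifs <;> nlinarith
  unfold Pattern.rate
  -- Some message is unshared and supplies the strict decrease. If both source messages are shared,
  -- so are the link letters, and activity forces a positive relay rate.
  by_cases h1 : f.x₁
  · by_cases h2 : f.x₂
    · have h3 : ¬f.x₃ := fun h3 => v4 ⟨h1, h2, h3⟩
      have := k3 h3 (v1 h1) (v2 h2)
      rw [if_neg h3, if_neg h3]
      nlinarith
    · linarith [b2 h2]
  · linarith [b1 h1]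

theorem rateRegion_subset_capacityRegion {W : X₁ → X₂ → X₃ → Y → ℝ}
    (hW : ∀ x₁ x₂ x₃, W x₁ x₂ x₃ ∈ stdSimplex ℝ Y) {C₁ C₂ : ℝ} (hC₁ : 0 ≤ C₁) (hC₂ : 0 ≤ C₂) :
    rateRegion W C₁ C₂ ⊆ capacityRegion W C₁ C₂ := by
  refine closure_minimal ?_ isClosed_closure
  rintro R ⟨⟨h1, h2, h3⟩, Q, U₁, U₂, _, _, _, P, hP⟩
  have hP' := (P.bounds_iff hW C₁ C₂ R.1 R.2.1 R.2.2).1 hP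
  refine mem_closure_of_eventually_mul ?_
  -- For R ≠ 0 the critical equality lR = C holds for at most one l, and not for l < 1 close to 1,
  -- so scaling also avoids it.
  have hne : ∀ R C : ℝ, ∀ᶠ l : ℝ in 𝓝[<] 1, l * R = C → l * R = 0 := by
    intro R C
    by_cases hR : R = 0
    · exact Filter.Eventually.of_forall fun l _ => by simp [hR]
    by_cases hRC : R = C
    · filter_upwards [eventually_mem_Ioo] with l hl h
      rw [← hRC] at h
      have : l = 1 := mul_right_cancel₀ hR (by rw [h, one_mul])
      exact absurd this hl.2.ne
    · have hc : Filter.Tendsto (fun l : ℝ => l * R) (𝓝[<] 1) (𝓝 (1 * R)) :=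
        ((continuous_id.mul continuous_const).tendsto 1).mono_left nhdsWithin_le_nhds
      rw [one_mul] at hc
      filter_upwards [hc.eventually_ne hRC] with l hl h using absurd h hl
  filter_upwards [eventually_mem_Ioo, hne R.1 C₁, hne R.2.1 C₂] with l hl n1 n2
  exact P.achievable hW (mul_nonneg hl.1.le h1) (mul_nonneg hl.1.le h2) (mul_nonneg hl.1.le h3)
    hC₁ hC₂ n1 n2 fun f hf hact =>
      (Pattern.rate_mul_lt hf hC₁ hC₂ h1 h2 h3 hl.1 hl.2 hact).trans_le (hP' f hf)

end Achievability

end RelayMAC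

theorem proposition3 {X₁ X₂ X₃ Y : Type*} [Fintype X₁] [Fintype X₂] [Fintype X₃] [Fintype Y]
    (W : X₁ → X₂ → X₃ → Y → ℝ) (hW : ∀ x₁ x₂ x₃, W x₁ x₂ x₃ ∈ stdSimplex ℝ Y)
    (C₁ C₂ : ℝ) (hC₁ : 0 ≤ C₁) (hC₂ : 0 ≤ C₂) :
    RelayMAC.capacityRegion W C₁ C₂ = RelayMAC.rateRegion W C₁ C₂ :=
  (closure_minimal (fun _ hR => hR.mem_rateRegion hW hC₁ hC₂) isClosed_closure).antisymm
    (RelayMAC.rateRegion_subset_capacityRegion hW hC₁ hC₂)
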